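/- Let $E$ be a finite non-empty set, $P=(P_{ij})_{i,j\in E}$ a stochastic matrix, acting on functions by $(Pf)(i)=\sum_jP_{ij}f(j)$. Let $G$ be a finite set with a probability distribution $q$, let $\phi=(\phi^E,\phi^G):E\times G\to E\times G$ be a bijection, and let $\alpha=\vartheta\circ\phi_1$ on $E\times G^{\mathbb Z}$, where $\phi_1$ applies $\phi$ to the coordinates $(i,g_1)$ of $(i,(g_n)_{n\in\mathbb Z})$ and $\vartheta$ is the left shift $(i,(g_n)_n)\mapsto(i,(g_{n+1})_n)$. Put $X_0(i,(g_n)_n)=i$, $Y_m(i,(g_n)_n)=g_m$. Assume that $(G,\phi,q^{\otimes\mathbb Z})$ is a standard dilation of $P^t$: under each $\mathbb P_k=\delta_k\otimes q^{\otimes\mathbb Z}$, $k\in E$, the process $X_t=X_0\circ\alpha^t$, $t\ge0$, is a Markov chain with transition matrix $P$, started at $k$, with respect to the filtration $\mathcal F_t=\sigma(X_0,Y_1,\dots,Y_t)$. Let $\mathbb E_k$ be the expectation under $\mathbb P_k$. For a finite set $S$ let $\mu_S$ be the uniform probability on $S$, $\{|i\rangle\}_{i\in S}$ the canonical orthonormal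 basis of $L^2(\mu_S)$, and $m_f$ multiplication by $f$. Let $\mathcal H=L^2(\mu_E)$, $\mathfrak Z=L^2(\mu_G)$, $\mathfrak Z_n=\mathfrak Z$ for $n\in\mathbb Z$, $$V=\sum_{i\in E,\,g\in G}|\phi(i,g)\rangle\langle i,g|\quad\text{on }\mathcal H\otimes\mathfrak Z,\qquad V_{gg'}=\sum_{i,j\in E}|i\rangle\langle i,g|\phi(j,g')\rangle\langle j|.$$ Let $\mathfrak A=\mathcal B(\mathcal H)\otimes\big(\bigotimes_{n\in\mathbb Z}\mathcal B(\mathfrak Z_n)\big)$ (spatial tensor product of $C^*$-algebras). It is represented faithfully on $\mathcal H\otimes\mathcal K_\psi$ for each unit vector $\psi\in\mathfrak Z$, where $\mathcal K_\psi=\bigotimes_{n\in\mathbb Z}\mathfrak Z_n$ is the infinite tensor product with stabilizing sequence $\psi_n\equiv\psi$. Let $J(A)=V_1^*\,\widehat\Theta(A)\,V_1$, where $V_1$ is $V$ acting on $\mathcal H\otimes\mathfrak Z_1$ and $\widehat\Theta(A)=\Theta^*A\,\Theta$ with $\Theta$ the left shift $\bigotimes z_n\mapsto\bigotimes z_{n+1}$.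 For a continuous $F:E\times G^{\mathbb Z}\to\mathbb C$ let $m_F\in\mathfrak A$ be its image under the $*$-homomorphism $C(E\times G^{\mathbb Z})=L^\infty(E)\otimes\bigotimes_nL^\infty(G_n)\to\mathfrak A$ that is $f\mapsto m_f$ on each tensor factor. Then $V$ is unitary, $J$ is a $*$-automorphism of $\mathfrak A$, and: (1) $J(m_F)=m_{F\circ\alpha}$ for every continuous $F:E\times G^{\mathbb Z}\to\mathbb C$. (2) Let $\upsilon=\sum_{g\in G}\sqrt{q_g}\,|g\rangle$, a unit vector in $\mathfrak Z$. (a) For every $k\in E$, all continuous $F_1,\dots,F_n:E\times G^{\mathbb Z}\to\mathbb C$ and every bounded continuous $\eta:\mathbb C^n\to\mathbb C$, $$\mathbb E_k[\eta(F_1,\dots,F_n)]=\operatorname{tr}\big[\eta(m_{F_1},\dots,m_{F_n})\;|k\rangle\langle k|\otimes|\upsilon^{\otimes\mathbb Z}\rangle\langle\upsilon^{\otimes\mathbb Z}|\big]$$ on $\mathcal H\otimes\mathcal K_\upsilon$, where $\eta(m_{F_1},\dots,m_{F_n})$ is the joint continuous functional calculus of the commuting normal operators $m_{F_i}$. (b)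 The map $$Ta=\sum_{g\in G}\Big(\sum_{g'\in G}\sqrt{q_{g'}}\,V_{gg'}^*\Big)\,a\,\Big(\sum_{g''\in G}\sqrt{q_{g''}}\,V_{gg''}\Big),\qquad a\in\mathcal B(\mathcal H),$$ is linear, bounded, completely positive, normal and unital, so that $(T^t)_{t\ge0}$ is a quantum dynamical semigroup. It extends $P^t$: $T m_f=m_{Pf}$ for all $f:E\to\mathbb C$. And $(\mathfrak Z,V,\upsilon)$ is a QP-dilation of $T^t$: for all $t\ge0$ and $a\in\mathcal B(\mathcal H)$, $$T^ta=\mathbb E_{\upsilon^{\otimes t}}[j_t(a)]=\mathbb E_{\upsilon^{\otimes\mathbb Z}}[J^t(a)].$$ Here $j_t:\mathcal B(\mathcal H)\to\mathcal B(\mathcal H)\otimes\mathcal B(\bigotimes_{n=1}^t\mathfrak Z_n)$ is given by $j_0(a)=a$ and $j_t(a)=\sum_{z,z'\in G}j_{t-1}\big(\mathbb E_{|z\rangle\langle z'|}[V^*(a\otimes1)V]\big)\otimes|z'\rangle\langle z|$. $\mathbb E_{|\kappa\rangle\langle\kappa'|}$ denotes the conditional expectation onto $\mathcal B(\mathcal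 H)$ with respect to $|\kappa\rangle\langle\kappa'|$, that is $\langle h,\mathbb E_{|\kappa\rangle\langle\kappa'|}[X]h'\rangle=\langle h\otimes\kappa',X(h'\otimes\kappa)\rangle$, and $\mathbb E_\kappa=\mathbb E_{|\kappa\rangle\langle\kappa|}$. -/

import Mathlib

open MeasureTheory
open scoped InnerProductSpace Topology

noncomputable section

namespace QPD

/-! ### The Hilbert space `H ⊗ ⨂_{n ∈ ℤ} Z_n` -/

section InfiniteTensor

set_option linter.unusedSectionVars false

variable {H Z : Type} [NormedAddCommGroup H] [InnerProductSpace ℂ H] [CompleteSpace H]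
  [NormedAddCommGroup Z] [InnerProductSpace ℂ Z]

abbrev UnitVec (Z : Type) [NormedAddCommGroup Z] : Type := {v : Z // ‖v‖ = 1}

/-- Sequences `(z_n)_{n ∈ ℤ}` in `Z` with `z_n = ψ` for all but finitely many `n`. -/
def TailSeq (ψ : UnitVec Z) : Type := {z : ℤ → Z // {n | z n ≠ ψ.1}.Finite}

/-- `⟨⨂ z_n, ⨂ w_n⟩ = ∏ ⟨z_n, w_n⟩`, a product with finitely many factors different from `1`. -/
def tailInner (ψ : UnitVec Z) (z w : TailSeq ψ) : ℂ := ∏ᶠ n, ⟪z.1 n, w.1 n⟫_ℂ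

theorem tailInner_eq_prod (ψ : UnitVec Z) (z w : TailSeq ψ) (N : Finset ℤ)
    (hz : ∀ n ∉ N, z.1 n = ψ.1) (hw : ∀ n ∉ N, w.1 n = ψ.1) :
    tailInner ψ z w = ∏ n ∈ N, ⟪z.1 n, w.1 n⟫_ℂ := by
  refine finprod_eq_prod_of_mulSupport_subset _ fun n hn => ?_
  by_contra h
  have h' : n ∉ N := by simpa using h
  apply hn
  simp [hz n h', hw n h', inner_self_eq_norm_sq_to_K, ψ.2]

theorem tailInner_symm (ψ : UnitVec Z) (z w : TailSeq ψ) :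
    star (tailInner ψ z w) = tailInner ψ w z := by
  classical
  have hz := z.2; have hw := w.2
  rw [tailInner_eq_prod ψ z w (hz.toFinset ∪ hw.toFinset) (by simp +contextual)
    (by simp +contextual),
    tailInner_eq_prod ψ w z (hz.toFinset ∪ hw.toFinset) (by simp +contextual)
    (by simp +contextual)]
  simp [star_prod]

open scoped ComplexOrder in
/-- The Gram matrix of the vectors `h ⊗ ⨂ z_n`. -/
theorem gram_posSemidef (ψ : UnitVec Z) {ι : Type} [Finite ι] (h : ι → H) (z : ι → TailSeq ψ) :
    (Matrix.of fun i j => ⟪h i, h j⟫_ℂ * tailInner ψ (z i) (z j)).PosSemidef := by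
  classical
  have := Fintype.ofFinite ι
  let N : Finset ℤ := Finset.univ.biUnion fun i => (z i).2.toFinset
  have hN : ∀ i, ∀ n ∉ N, (z i).1 n = ψ.1 := by
    intro i n hn
    by_contra hne
    exact hn (Finset.mem_biUnion.2 ⟨i, Finset.mem_univ _, by simpa using hne⟩)
  have key : ∀ M : Finset ℤ,
      (Matrix.of fun i j => ⟪h i, h j⟫_ℂ * ∏ n ∈ M, ⟪(z i).1 n, (z j).1 n⟫_ℂ).PosSemidef := by
    intro M
    induction M using Finset.induction_on with
    | empty =>
      simpa [Matrix.gram] using Matrix.posSemidef_gram ℂ h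
    | insert a s ha ih =>
      convert! ih.hadamard (Matrix.posSemidef_gram ℂ fun i => (z i).1 a) using 1
      ext i j
      simp [Finset.prod_insert ha, Matrix.gram]
      ring
  convert! key N using 1
  ext i j
  simp [tailInner_eq_prod ψ (z i) (z j) N (hN i) (hN j)]

/-- The operator-valued kernel `(z, w) ↦ ⟨⨂ z_n, ⨂ w_n⟩ 1_H` on sequences. -/
def tensorKernel (H : Type) [NormedAddCommGroup H] [InnerProductSpace ℂ H] [CompleteSpace H]
    (ψ : UnitVec Z) : Matrix (TailSeq ψ) (TailSeq ψ) (H →L[ℂ] H) :=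
  Matrix.of fun z w => tailInner ψ z w • 1

theorem tensorKernel_posSemidef (ψ : UnitVec Z) : (tensorKernel H ψ).PosSemidef := by
  have htf := (RKHS.posSemidef_tfae (K := tensorKernel H ψ)).out 0 2
  refine htf.2 ⟨?_, fun f => ?_⟩
  · ext z w : 1
    simp only [tensorKernel, Matrix.conjTranspose_apply, Matrix.of_apply, star_smul,
      tailInner_symm, star_one]
  · have h := (gram_posSemidef ψ (fun i : f.support => f i) (fun i => i.1)).re_dotProduct_nonneg
      (fun _ => 1)
    refine h.trans_eq ?_
    simp only [dotProduct, Matrix.mulVec, Finsupp.sum]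
    rw [← Finset.sum_coe_sort f.support]
    simp only [Pi.star_apply, star_one, one_mul, mul_one, Matrix.of_apply]
    congr 1
    refine Finset.sum_congr rfl fun i _ => ?_
    rw [← Finset.sum_coe_sort f.support]
    refine Finset.sum_congr rfl fun j _ => ?_
    simp only [tensorKernel, Matrix.of_apply, FunLike.coe_smul, Pi.smul_apply,
      inner_smul_left, one_apply_eq_self]
    rw [mul_comm, ← tailInner_symm ψ j i]
    simp

instance (ψ : UnitVec Z) : Fact (tensorKernel H ψ).PosSemidef := ⟨tensorKernel_posSemidef ψ⟩

/-- The Hilbert space `H ⊗ ⨂_{n ∈ ℤ} Z_n`, `Z_n = Z`, where the infinite tensor product is taken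
with respect to the stabilizing sequence `ψ_n = ψ`: the Hilbert space generated by the
vectors `h ⊗ ⨂ z_n`, `z_n = ψ` for all but finitely many `n`, with
`⟨h ⊗ ⨂ z_n, h' ⊗ ⨂ w_n⟩ = ⟨h, h'⟩ ∏ ⟨z_n, w_n⟩`. -/
def HK (H : Type) [NormedAddCommGroup H] [InnerProductSpace ℂ H] [CompleteSpace H]
    (ψ : UnitVec Z) : Type := RKHS.OfKernel (tensorKernel H ψ)

instance (ψ : UnitVec Z) : NormedAddCommGroup (HK H ψ) :=
  inferInstanceAs (NormedAddCommGroup (RKHS.OfKernel (tensorKernel H ψ)))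
instance (ψ : UnitVec Z) : InnerProductSpace ℂ (HK H ψ) :=
  inferInstanceAs (InnerProductSpace ℂ (RKHS.OfKernel (tensorKernel H ψ)))
instance (ψ : UnitVec Z) : CompleteSpace (HK H ψ) :=
  inferInstanceAs (CompleteSpace (RKHS.OfKernel (tensorKernel H ψ)))
instance (ψ : UnitVec Z) : RKHS ℂ (HK H ψ) (TailSeq ψ) H :=
  inferInstanceAs (RKHS ℂ (RKHS.OfKernel (tensorKernel H ψ)) (TailSeq ψ) H)

/-- `tens z h = h ⊗ ⨂ z_n`. -/
def tens {ψ : UnitVec Z} (z : TailSeq ψ) : H →L[ℂ] HK H ψ := RKHS.kerFun (HK H ψ) z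

theorem tens_inner {ψ : UnitVec Z} (z w : TailSeq ψ) (h k : H) :
    ⟪tens z h, tens w k⟫_ℂ = ⟪h, k⟫_ℂ * tailInner ψ z w := by
  have hk : RKHS.kernel (HK H ψ) = tensorKernel H ψ :=
    RKHS.OfKernel.kernel_ofKernel (K := tensorKernel H ψ)
  rw [tens, tens, ← RKHS.kernel_inner, hk]
  simp only [tensorKernel, Matrix.of_apply, FunLike.coe_smul, Pi.smul_apply,
      inner_smul_left, one_apply_eq_self]
  rw [mul_comm, ← tailInner_symm ψ w z]
  simp

/-- Finite linear combinations of elementary tensors. -/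
def comb (ψ : UnitVec Z) : (TailSeq ψ × H →₀ ℂ) →ₗ[ℂ] HK H ψ :=
  Finsupp.linearCombination ℂ fun p => tens p.1 p.2

theorem comb_dense (ψ : UnitVec Z) : DenseRange (comb (H := H) ψ) := by
  have h := RKHS.kerFun_dense (HK H ψ)
  rw [← Submodule.dense_iff_topologicalClosure_eq_top] at h
  rw [DenseRange, ← LinearMap.coe_range]
  convert! h using 2
  rw [comb, Finsupp.range_linearCombination]
  congr 1
  ext x
  simp [tens]

theorem ext_tens {ψ : UnitVec Z} {F : Type} [NormedAddCommGroup F] [InnerProductSpace ℂ F]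
    {A B : HK H ψ →L[ℂ] F}
    (h : ∀ (z : TailSeq ψ) (k : H), A (tens z k) = B (tens z k)) : A = B := by
  refine ContinuousLinearMap.coeFn_injective
    ((comb_dense (H := H) ψ).equalizer A.continuous B.continuous ?_)
  ext1 f
  simp [comb, Finsupp.linearCombination_apply, Finsupp.sum, map_sum, h]

theorem eq_of_inner_tens {ψ : UnitVec Z} {x y : HK H ψ}
    (h : ∀ (z : TailSeq ψ) (k : H), ⟪tens z k, x⟫_ℂ = ⟪tens z k, y⟫_ℂ) : x = y := by
  have : innerSL ℂ x = innerSL ℂ y := by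
    refine ext_tens fun z k => ?_
    rw [innerSL_apply_apply, innerSL_apply_apply, ← inner_conj_symm, h, inner_conj_symm]
  refine ext_inner_right ℂ fun v => ?_
  simpa using congrArg (fun T => T v) this

/-- The bounded operator with prescribed values `L (z, h)` on the vectors `h ⊗ ⨂ z_n`. -/
def opOf {ψ : UnitVec Z} (L : TailSeq ψ × H → HK H ψ) : HK H ψ →L[ℂ] HK H ψ :=
  (Finsupp.linearCombination ℂ L).extendOfNorm (comb ψ)

theorem opOf_tens {ψ : UnitVec Z} (L M : TailSeq ψ × H → HK H ψ) (C : ℝ) (hC : 0 ≤ C)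
    (h : ∀ p q, ⟪L p, L q⟫_ℂ + ⟪M p, M q⟫_ℂ = (C : ℂ) ^ 2 * ⟪tens p.1 p.2, tens q.1 q.2⟫_ℂ)
    (z : TailSeq ψ) (k : H) : opOf L (tens z k) = L (z, k) := by
  have hb : ∀ f, ‖Finsupp.linearCombination ℂ L f‖ ≤ C * ‖comb ψ f‖ := by
    intro f
    refine abs_le_of_sq_le_sq' ?_ (by positivity) |>.2
    have e : ∀ N : TailSeq ψ × H → HK H ψ, ((‖Finsupp.linearCombination ℂ N f‖ ^ 2 : ℝ) : ℂ)
        = f.sum fun p c => f.sum fun q d => star c * d * ⟪N p, N q⟫_ℂ := by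
      intro N
      have := inner_self_eq_norm_sq_to_K (𝕜 := ℂ) (Finsupp.linearCombination ℂ N f)
      push_cast
      rw [← Complex.coe_algebraMap, ← this, Finsupp.linearCombination_apply]
      simp only [Finsupp.sum, sum_inner, inner_sum, inner_smul_left, inner_smul_right]
      rw [Finset.sum_comm]
      refine Finset.sum_congr rfl fun p _ => ?_
      rw [Finset.mul_sum]
      refine Finset.sum_congr rfl fun q _ => ?_
      simp only [Complex.star_def]; ring
    have e2 : ((‖Finsupp.linearCombination ℂ L f‖ ^ 2 : ℝ) : ℂ)
        + ((‖Finsupp.linearCombination ℂ M f‖ ^ 2 : ℝ) : ℂ)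
        = (((C * ‖comb ψ f‖) ^ 2 : ℝ) : ℂ) := by
      rw [mul_pow, Complex.ofReal_mul, comb, e L, e M, e, ← Finsupp.sum_add]
      simp only [Finsupp.sum, Finset.mul_sum, ← Finset.sum_add_distrib]
      refine Finset.sum_congr rfl fun p _ => Finset.sum_congr rfl fun q _ => ?_
      rw [← mul_add, h]
      push_cast; ring
    have e3 : ‖Finsupp.linearCombination ℂ L f‖ ^ 2 + ‖Finsupp.linearCombination ℂ M f‖ ^ 2
        = (C * ‖comb ψ f‖) ^ 2 := by exact_mod_cast e2
    nlinarith [sq_nonneg ‖Finsupp.linearCombination ℂ M f‖]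
  have := LinearMap.extendOfNorm_eq (comb_dense ψ) ⟨C, hb⟩ (Finsupp.single (z, k) 1)
  simpa [opOf, comb] using this

/-- The defect identity that bounds `a ↦ a ⊗ 1`. -/
theorem exists_defect {W : Type} [NormedAddCommGroup W] [InnerProductSpace ℂ W] [CompleteSpace W]
    (b : W →L[ℂ] W) : ∃ c : W →L[ℂ] W, ∀ u v : W,
      ⟪b u, b v⟫_ℂ + ⟪c u, c v⟫_ℂ = (‖b‖ : ℂ) ^ 2 * ⟪u, v⟫_ℂ := by
  have h0 : 0 ≤ algebraMap ℝ (W →L[ℂ] W) (‖b‖ ^ 2) - star b * b := by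
    rw [sub_nonneg]
    have := CStarAlgebra.star_mul_le_algebraMap_norm_sq (a := b)
    exact this
  obtain ⟨c, hc⟩ := CStarAlgebra.nonneg_iff_eq_star_mul_self.1 h0
  refine ⟨c, fun u v => ?_⟩
  have h1 : ⟪u, (star c * c) v⟫_ℂ = ⟪c u, c v⟫_ℂ := by
    rw [ContinuousLinearMap.star_eq_adjoint, mul_apply_eq_comp]
    simp [ContinuousLinearMap.adjoint_inner_right]
  have h2 : ⟪u, (star b * b) v⟫_ℂ = ⟪b u, b v⟫_ℂ := by
    rw [ContinuousLinearMap.star_eq_adjoint, mul_apply_eq_comp]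
    simp [ContinuousLinearMap.adjoint_inner_right]
  rw [← h1, ← h2, ← hc]
  simp [Algebra.algebraMap_eq_smul_one, inner_smul_right_eq_smul]

theorem star_eq_of_inner {ψ : UnitVec Z} {A B : HK H ψ →L[ℂ] HK H ψ}
    (h : ∀ (z w : TailSeq ψ) (k l : H),
      ⟪tens z k, A (tens w l)⟫_ℂ = ⟪B (tens z k), tens w l⟫_ℂ) : A = star B := by
  refine ext_tens fun w l => eq_of_inner_tens fun z k => ?_
  rw [h, ContinuousLinearMap.star_eq_adjoint, ContinuousLinearMap.adjoint_inner_right]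

/-- `a ⊗ 1` for `a ∈ B(H)`. -/
def sysOp (ψ : UnitVec Z) (a : H →L[ℂ] H) : HK H ψ →L[ℂ] HK H ψ :=
  opOf fun p => tens p.1 (a p.2)

theorem sysOp_tens {ψ : UnitVec Z} (a : H →L[ℂ] H) (z : TailSeq ψ) (k : H) :
    sysOp ψ a (tens z k) = tens z (a k) := by
  obtain ⟨c, hc⟩ := exists_defect a
  refine opOf_tens _ (fun p => tens p.1 (c p.2)) ‖a‖ (norm_nonneg _) (fun p q => ?_) z k
  simp only [tens_inner]
  rw [← add_mul, hc, mul_assoc]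

/-- The *-homomorphism `a ↦ a ⊗ 1` from `B(H)` to `B(H ⊗ ⨂ Z_n)`. -/
def sysHom (ψ : UnitVec Z) : (H →L[ℂ] H) →⋆ₐ[ℂ] (HK H ψ →L[ℂ] HK H ψ) where
  toFun := sysOp ψ
  map_one' := ext_tens fun z k => by simp [sysOp_tens]
  map_mul' a b := ext_tens fun z k => by simp [sysOp_tens]
  map_zero' := ext_tens fun z k => by simp [sysOp_tens]
  map_add' a b := ext_tens fun z k => by simp [sysOp_tens]
  commutes' r := ext_tens fun z k => by
    simp [sysOp_tens, Algebra.algebraMap_eq_smul_one]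
  map_star' a := star_eq_of_inner fun z w k l => by
    rw [sysOp_tens, sysOp_tens, tens_inner, tens_inner, ContinuousLinearMap.star_eq_adjoint,
      ContinuousLinearMap.adjoint_inner_right]

/-- Replace the vector at site `n`. -/
def TailSeq.set {ψ : UnitVec Z} (z : TailSeq ψ) (n : ℤ) (v : Z) : TailSeq ψ :=
  ⟨Function.update z.1 n v, (z.2.union (Set.finite_singleton n)).subset fun m hm => by
    by_cases h : m = n
    · exact Or.inr h
    · exact Or.inl (by simpa [Function.update_of_ne h] using hm)⟩

theorem TailSeq.set_self {ψ : UnitVec Z} (z : TailSeq ψ) (n : ℤ) : z.set n (z.1 n) = z :=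
  Subtype.ext (Function.update_eq_self n z.1)

theorem TailSeq.set_same {ψ : UnitVec Z} (z : TailSeq ψ) (n : ℤ) (v : Z) :
    (z.set n v).1 n = v := by simp [TailSeq.set]

theorem TailSeq.set_ne {ψ : UnitVec Z} (z : TailSeq ψ) {m n : ℤ} (h : m ≠ n) (v : Z) :
    (z.set n v).1 m = z.1 m := by simp [TailSeq.set, h]

theorem TailSeq.set_set {ψ : UnitVec Z} (z : TailSeq ψ) (n : ℤ) (u v : Z) :
    (z.set n u).set n v = z.set n v :=
  Subtype.ext (by simp [TailSeq.set])

theorem TailSeq.set_comm {ψ : UnitVec Z} (z : TailSeq ψ) {m n : ℤ} (h : m ≠ n) (u v : Z) :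
    (z.set m u).set n v = (z.set n v).set m u :=
  Subtype.ext (by simpa [TailSeq.set] using Function.update_comm h u v z.1)

theorem tailInner_set {ψ : UnitVec Z} (z w : TailSeq ψ) (n : ℤ) :
    ∃ r : ℂ, ∀ u v : Z, tailInner ψ (z.set n u) (w.set n v) = ⟪u, v⟫_ℂ * r := by
  classical
  let N : Finset ℤ := insert n (z.2.toFinset ∪ w.2.toFinset)
  refine ⟨∏ m ∈ N.erase n, ⟪z.1 m, w.1 m⟫_ℂ, fun u v => ?_⟩
  rw [tailInner_eq_prod ψ _ _ N, ← Finset.mul_prod_erase N _ (Finset.mem_insert_self n _), TailSeq.set_same,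
    TailSeq.set_same]
  · congr 1
    refine Finset.prod_congr rfl fun m hm => ?_
    rw [TailSeq.set_ne _ (Finset.ne_of_mem_erase hm), TailSeq.set_ne _ (Finset.ne_of_mem_erase hm)]
  · intro m hm
    have : m ≠ n := fun h => hm (by simp [N, h])
    rw [TailSeq.set_ne _ this]
    by_contra h
    exact hm (by simp [N, h])
  · intro m hm
    have : m ≠ n := fun h => hm (by simp [N, h])
    rw [TailSeq.set_ne _ this]
    by_contra h
    exact hm (by simp [N, h])

/-- `z ⊗ ...` is linear in the vector at each site. -/
def tensSite {ψ : UnitVec Z} (z : TailSeq ψ) (n : ℤ) (k : H) : Z →ₗ[ℂ] HK H ψ where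
  toFun v := tens (z.set n v) k
  map_add' u v := eq_of_inner_tens fun w l => by
    obtain ⟨r, hr⟩ := tailInner_set w z n
    rw [← w.set_self n]
    simp only [inner_add_right, tens_inner, hr]
    ring
  map_smul' c u := eq_of_inner_tens fun w l => by
    obtain ⟨r, hr⟩ := tailInner_set w z n
    rw [← w.set_self n]
    simp only [inner_smul_right, tens_inner, hr, RingHom.id_apply]
    ring

variable [CompleteSpace Z]

/-- `b ∈ B(Z)` acting on the factor `Z_n`. -/
def siteOp (H : Type) [NormedAddCommGroup H] [InnerProductSpace ℂ H] [CompleteSpace H]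
    (ψ : UnitVec Z) (n : ℤ) (b : Z →L[ℂ] Z) : HK H ψ →L[ℂ] HK H ψ :=
  opOf fun p => tens (p.1.set n (b (p.1.1 n))) p.2

theorem siteOp_tens {ψ : UnitVec Z} (n : ℤ) (b : Z →L[ℂ] Z) (z : TailSeq ψ) (k : H) :
    siteOp H ψ n b (tens z k) = tens (z.set n (b (z.1 n))) k := by
  obtain ⟨c, hc⟩ := exists_defect b
  refine opOf_tens _ (fun p => tens (p.1.set n (c (p.1.1 n))) p.2) ‖b‖ (norm_nonneg _)
    (fun p q => ?_) z k
  obtain ⟨r, hr⟩ := tailInner_set p.1 q.1 n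
  have h0 : tailInner ψ p.1 q.1 = ⟪p.1.1 n, q.1.1 n⟫_ℂ * r := by
    rw [← hr, TailSeq.set_self, TailSeq.set_self]
  simp only [tens_inner, hr, h0]
  linear_combination ⟪p.2, q.2⟫_ℂ * r * hc (p.1.1 n) (q.1.1 n)

theorem tens_set_add {ψ : UnitVec Z} (z : TailSeq ψ) (n : ℤ) (k : H) (u v : Z) :
    tens (z.set n (u + v)) k = tens (z.set n u) k + tens (z.set n v) k :=
  (tensSite z n k).map_add u v

theorem tens_set_smul {ψ : UnitVec Z} (z : TailSeq ψ) (n : ℤ) (k : H) (c : ℂ) (u : Z) :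
    tens (z.set n (c • u)) k = c • tens (z.set n u) k :=
  (tensSite z n k).map_smul c u

theorem tens_set_zero {ψ : UnitVec Z} (z : TailSeq ψ) (n : ℤ) (k : H) :
    tens (z.set n 0) k = 0 :=
  (tensSite z n k).map_zero

/-- The *-homomorphism from `B(Z)` to `B(H ⊗ ⨂ Z_n)` acting on the factor `Z_n`. -/
def siteHom (H : Type) [NormedAddCommGroup H] [InnerProductSpace ℂ H] [CompleteSpace H]
    (ψ : UnitVec Z) (n : ℤ) : (Z →L[ℂ] Z) →⋆ₐ[ℂ] (HK H ψ →L[ℂ] HK H ψ) where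
  toFun := siteOp H ψ n
  map_one' := ext_tens fun z k => by simp [siteOp_tens, TailSeq.set_self]
  map_mul' a b := ext_tens fun z k => by
    simp [siteOp_tens, TailSeq.set_set, TailSeq.set_same]
  map_zero' := ext_tens fun z k => by simp [siteOp_tens, tens_set_zero]
  map_add' a b := ext_tens fun z k => by simp [siteOp_tens, tens_set_add]
  commutes' r := ext_tens fun z k => by
    simp [siteOp_tens, Algebra.algebraMap_eq_smul_one, tens_set_smul, TailSeq.set_self]
  map_star' b := star_eq_of_inner fun z w k l => by
    obtain ⟨r, hr⟩ := tailInner_set z w n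
    have h1 := hr (z.1 n) (star b (w.1 n))
    have h2 := hr (b (z.1 n)) (w.1 n)
    rw [TailSeq.set_self] at h1 h2
    rw [siteOp_tens, siteOp_tens, tens_inner, tens_inner, h1, h2,
      ContinuousLinearMap.star_eq_adjoint, ContinuousLinearMap.adjoint_inner_right]

theorem sysHom_commute {ψ : UnitVec Z} (a : H →L[ℂ] H) (n : ℤ) (b : Z →L[ℂ] Z) :
    Commute (sysHom ψ a) (siteHom H ψ n b) :=
  ext_tens fun z k => by
    change sysOp ψ a (siteOp H ψ n b (tens z k)) = siteOp H ψ n b (sysOp ψ a (tens z k))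
    simp [sysOp_tens, siteOp_tens]

theorem siteHom_commute {ψ : UnitVec Z} {m n : ℤ} (h : m ≠ n) (b c : Z →L[ℂ] Z) :
    Commute (siteHom H ψ m b) (siteHom H ψ n c) :=
  ext_tens fun z k => by
    change siteOp H ψ m b (siteOp H ψ n c (tens z k)) = siteOp H ψ n c (siteOp H ψ m b (tens z k))
    simp [siteOp_tens, TailSeq.set_ne _ h, TailSeq.set_ne _ h.symm, TailSeq.set_comm _ h]

/-- The sequence `(z_{n+1})_n`. -/
def TailSeq.shift {ψ : UnitVec Z} (z : TailSeq ψ) : TailSeq ψ :=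
  ⟨fun n => z.1 (n + 1), z.2.preimage (add_left_injective (1 : ℤ)).injOn⟩

/-- The left shift operator `Θ`, extended to `H ⊗ ⨂ Z_n`:
`Θ (h ⊗ ⨂ z_n) = h ⊗ ⨂ z_{n+1}`. -/
def shiftOp (H : Type) [NormedAddCommGroup H] [InnerProductSpace ℂ H] [CompleteSpace H]
    (ψ : UnitVec Z) : HK H ψ →L[ℂ] HK H ψ :=
  opOf fun p => tens p.1.shift p.2

theorem tailInner_shift {ψ : UnitVec Z} (z w : TailSeq ψ) :
    tailInner ψ z.shift w.shift = tailInner ψ z w :=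
  finprod_eq_of_bijective (fun n : ℤ => n + 1) (Equiv.addRight (1 : ℤ)).bijective fun _ => rfl

theorem shiftOp_tens {ψ : UnitVec Z} (z : TailSeq ψ) (k : H) :
    shiftOp H ψ (tens z k) = tens z.shift k :=
  opOf_tens _ (fun _ => 0) 1 zero_le_one (fun p q => by simp [tens_inner, tailInner_shift]) z k

/-- The C*-algebra `B(H) ⊗ (⨂_{n ∈ ℤ} B(Z_n))`, represented on `H ⊗ ⨂ Z_n`. -/
def globalAlg (H : Type) [NormedAddCommGroup H] [InnerProductSpace ℂ H] [CompleteSpace H]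
    (ψ : UnitVec Z) : StarSubalgebra ℂ (HK H ψ →L[ℂ] HK H ψ) :=
  (StarAlgebra.adjoin ℂ (Set.range (sysHom ψ) ∪ ⋃ n : ℤ, Set.range (siteHom H ψ n))).topologicalClosure

/-- The constant sequence, and the vector `h ⊗ ψ^{⊗ℤ}`. -/
def constSeq (ψ : UnitVec Z) : TailSeq ψ := ⟨fun _ => ψ.1, by simp⟩

def vac (ψ : UnitVec Z) : H →L[ℂ] HK H ψ := tens (constSeq ψ)

/-- The conditional expectation `B(H ⊗ ⨂ Z_n) → B(H)` with respect to the vector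
`ψ^{⊗ℤ}`: `⟨h, E[A] k⟩ = ⟨h ⊗ ψ^{⊗ℤ}, A (k ⊗ ψ^{⊗ℤ})⟩`. -/
def condExpVac (ψ : UnitVec Z) (A : HK H ψ →L[ℂ] HK H ψ) : H →L[ℂ] H :=
  (vac ψ).adjoint ∘L A ∘L vac ψ

end InfiniteTensor

/-! ### Joint functional calculus and functions on `E × G^ℤ` -/

section Gelfand

open WeakDual

variable {A : Type} [CStarAlgebra A]

/-- The unital C*-algebra generated by `s`. -/
abbrev genAlg (s : Set A) : StarSubalgebra ℂ A := (StarAlgebra.adjoin ℂ s).topologicalClosure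

theorem mem_genAlg {s : Set A} {a : A} (h : a ∈ s) : a ∈ genAlg s :=
  StarSubalgebra.le_topologicalClosure _ (StarAlgebra.subset_adjoin ℂ s h)

instance (s : Set A) : CStarAlgebra (genAlg s) :=
  StarSubalgebra.cstarAlgebra (genAlg s) (h_closed := isClosed_closure)

/-- The generated C*-algebra is abelian if the generators and their adjoints commute. -/
abbrev genAlgComm (s : Set A) (h1 : ∀ a ∈ s, ∀ b ∈ s, a * b = b * a)
    (h2 : ∀ a ∈ s, ∀ b ∈ s, a * star b = star b * a) : CommCStarAlgebra (genAlg s) :=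
  { (inferInstance : CStarAlgebra (genAlg s)) with
    mul_comm := by
      have := StarAlgebra.isMulCommutative_adjoin ℂ h1 h2
      exact (StarSubalgebra.commRingTopologicalClosure (StarAlgebra.adjoin ℂ s)
        (fun x y => this.is_comm.comm x y)).mul_comm }

/-- `b = η(a_1, …, a_n)`: the element `b` of the C*-algebra generated by the `a_i` whose Gelfand
transform is `χ ↦ η (χ a_1, …, χ a_n)`. -/
def IsJointCFC {n : ℕ} (a : Fin n → A) (η : (Fin n → ℂ) → ℂ) (b : A) : Prop :=
  ∃ hb : b ∈ genAlg (Set.range a), ∀ χ : characterSpace ℂ (genAlg (Set.range a)),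
    χ ⟨b, hb⟩ = η fun i => χ ⟨a i, mem_genAlg ⟨i, rfl⟩⟩

theorem existsUnique_jointCFC {n : ℕ} (a : Fin n → A) (h1 : ∀ i j, Commute (a i) (a j))
    (h2 : ∀ i j, Commute (a i) (star (a j))) (η : (Fin n → ℂ) → ℂ) (hη : Continuous η) :
    ∃! b, IsJointCFC a η b := by
  let _ : CommCStarAlgebra (genAlg (Set.range a)) := genAlgComm _
    (by rintro _ ⟨i, rfl⟩ _ ⟨j, rfl⟩; exact h1 i j)
    (by rintro _ ⟨i, rfl⟩ _ ⟨j, rfl⟩; exact h2 i j)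
  let f : C(characterSpace ℂ (genAlg (Set.range a)), ℂ) :=
    ⟨fun χ => η fun i => χ ⟨a i, mem_genAlg ⟨i, rfl⟩⟩, hη.comp <| continuous_pi fun i =>
      map_continuous (gelfandTransform ℂ (genAlg (Set.range a)) ⟨a i, mem_genAlg ⟨i, rfl⟩⟩)⟩
  obtain ⟨b, hb⟩ := (gelfandStarTransform (genAlg (Set.range a))).surjective f
  replace hb : gelfandStarTransform (genAlg (Set.range a)) b = f := hb
  refine ⟨b, ⟨b.2, fun χ => congrArg (fun g => g χ) hb⟩, ?_⟩
  rintro c ⟨hc, h⟩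
  have : gelfandStarTransform (genAlg (Set.range a)) ⟨c, hc⟩
      = gelfandStarTransform (genAlg (Set.range a)) b := by
    rw [hb]
    ext χ
    exact h χ
  exact congrArg Subtype.val ((gelfandStarTransform (genAlg (Set.range a))).injective this)

open Classical in
/-- Joint continuous functional calculus `η(a_1, …, a_n)` of commuting normal elements. -/
def jointCFC {n : ℕ} (a : Fin n → A) (η : (Fin n → ℂ) → ℂ) : A :=
  if h : ∃ b, IsJointCFC a η b then h.choose else 0

variable {E G : Type} [Fintype E] [DecidableEq E] [TopologicalSpace E] [DiscreteTopology E]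
  [Fintype G] [DecidableEq G] [TopologicalSpace G] [DiscreteTopology G]

/-- The global random variable `f(X_0)`. -/
def sysVar (G : Type) [TopologicalSpace G] (f : E → ℂ) : C(E × (ℤ → G), ℂ) :=
  ⟨fun ω => f ω.1, continuous_of_discreteTopology.comp continuous_fst⟩

/-- The global random variable `f(Y_n)`. -/
def siteVar (E : Type) [TopologicalSpace E] (n : ℤ) (f : G → ℂ) : C(E × (ℤ → G), ℂ) :=
  ⟨fun ω => f (ω.2 n), continuous_of_discreteTopology.comp
    ((continuous_apply n).comp continuous_snd)⟩

theorem exists_point {S : Type} [Fintype S] [DecidableEq S]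
    {B : Type} [CommCStarAlgebra B] (e : (S → ℂ) →⋆ₐ[ℂ] B) (χ : characterSpace ℂ B) :
    ∃ i, ∀ f, χ (e f) = f i := by
  have h1 : ∑ i, χ (e (Pi.single i 1)) = 1 := by
    rw [← map_sum, ← map_sum, show ∑ i : S, Pi.single i (1 : ℂ) = 1 from
      Finset.univ_sum_single (1 : S → ℂ), map_one, map_one]
  obtain ⟨i, hi⟩ : ∃ i, χ (e (Pi.single i 1)) ≠ 0 := by
    by_contra! h
    simp [h] at h1
  refine ⟨i, fun f => mul_right_cancel₀ hi ?_⟩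
  rw [← map_mul, ← map_mul, show f * Pi.single i 1 = f i • Pi.single i (1 : ℂ) by
    ext j; by_cases h : j = i
    · subst h; simp
    · simp [h], map_smul, map_smul, smul_eq_mul]

/-- There is exactly one *-homomorphism on `C(E × G^ℤ)` with given commuting restrictions to the
functions of each coordinate. -/
theorem existsUnique_tensorHom (u : (E → ℂ) →⋆ₐ[ℂ] A) (w : ℤ → (G → ℂ) →⋆ₐ[ℂ] A)
    (h1 : ∀ f n g, Commute (u f) (w n g)) (h2 : ∀ m n, m ≠ n → ∀ f g, Commute (w m f) (w n g)) :
    ∃! m : C(E × (ℤ → G), ℂ) →⋆ₐ[ℂ] A,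
      (∀ f, m (sysVar G f) = u f) ∧ ∀ n f, m (siteVar E n f) = w n f := by
  refine existsUnique_of_exists_of_unique ?_ ?_
  · let s : Set A := Set.range u ∪ ⋃ n, Set.range (w n)
    have hc : ∀ a ∈ s, ∀ b ∈ s, a * b = b * a := by
      intro a ha b hb
      simp only [s, Set.mem_union, Set.mem_range, Set.mem_iUnion] at ha hb
      obtain ⟨f, rfl⟩ | ⟨n, f, rfl⟩ := ha <;> obtain ⟨g, rfl⟩ | ⟨k, g, rfl⟩ := hb
      · rw [← map_mul, ← map_mul, mul_comm]
      · exact h1 _ _ _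
      · exact (h1 _ _ _).symm
      · by_cases h : n = k
        · subst h; rw [← map_mul, ← map_mul, mul_comm]
        · exact h2 _ _ h _ _
    have hs : ∀ b ∈ s, star b ∈ s := by
      intro b hb
      simp only [s, Set.mem_union, Set.mem_range, Set.mem_iUnion] at hb ⊢
      obtain ⟨g, rfl⟩ | ⟨k, g, rfl⟩ := hb
      · exact Or.inl ⟨star g, map_star _ _⟩
      · exact Or.inr ⟨k, star g, map_star _ _⟩
    let _ : CommCStarAlgebra (genAlg s) := genAlgComm s hc fun a ha b hb => hc a ha _ (hs b hb)
    have hu : ∀ f, u f ∈ genAlg s := fun f => mem_genAlg (Or.inl ⟨f, rfl⟩)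
    have hw : ∀ n f, w n f ∈ genAlg s := fun n f =>
      mem_genAlg (Or.inr (Set.mem_iUnion.2 ⟨n, f, rfl⟩))
    let u' : (E → ℂ) →⋆ₐ[ℂ] genAlg s := u.codRestrict (genAlg s) hu
    let w' : ℤ → (G → ℂ) →⋆ₐ[ℂ] genAlg s := fun n => (w n).codRestrict (genAlg s) (hw n)
    choose p hp using fun χ : characterSpace ℂ (genAlg s) => exists_point u' χ
    choose q hq using fun (χ : characterSpace ℂ (genAlg s)) (n : ℤ) => exists_point (w' n) χ
    have cont : ∀ {S : Type} [Fintype S] [DecidableEq S] [TopologicalSpace S] [DiscreteTopology S]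
        (e : (S → ℂ) →⋆ₐ[ℂ] genAlg s) (r : characterSpace ℂ (genAlg s) → S)
        (_ : ∀ (χ : characterSpace ℂ (genAlg s)) (f : S → ℂ), χ (e f) = f (r χ)), Continuous r := by
      intro S _ _ _ _ e r hr
      rw [continuous_discrete_rng]
      intro i
      have : r ⁻¹' {i} = (fun χ : characterSpace ℂ (genAlg s) => χ (e (Pi.single i 1))) ⁻¹' {0}ᶜ := by
        ext χ
        simp [hr, Pi.single_apply]
      rw [this]
      exact isOpen_compl_singleton.preimage
        (map_continuous (gelfandTransform ℂ (genAlg s) (e (Pi.single i 1))))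
    let θ : C(characterSpace ℂ (genAlg s), E × (ℤ → G)) :=
      ⟨fun χ => (p χ, q χ), (cont u' p hp).prodMk
        (continuous_pi fun n => cont (w' n) (fun χ => q χ n) fun χ => hq χ n)⟩
    let γ := (gelfandStarTransform (genAlg s)).symm
    have hγ : ∀ b F, gelfandStarTransform (genAlg s) b = F → γ F = b := by
      intro b F h
      rw [← h]
      exact (gelfandStarTransform (genAlg s)).symm_apply_apply b
    refine ⟨((genAlg s).subtype.comp (γ : C(characterSpace ℂ (genAlg s), ℂ) →⋆ₐ[ℂ] genAlg s)).comp
      (θ.compStarAlgHom' ℂ ℂ), fun f => ?_, fun n f => ?_⟩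
    · change ((γ ((sysVar G f).comp θ) : genAlg s) : A) = u f
      rw [hγ (u' f)]
      · rfl
      · ext χ
        exact hp χ f
    · change ((γ ((siteVar E n f).comp θ) : genAlg s) : A) = w n f
      rw [hγ (w' n f)]
      · rfl
      · ext χ
        exact hq χ n f
  · rintro m m' ⟨hm, hm'⟩ ⟨hn, hn'⟩
    let S : StarSubalgebra ℂ C(E × (ℤ → G), ℂ) := StarAlgHom.equalizer m m'
    have hS : S.topologicalClosure = ⊤ := by
      refine ContinuousMap.starSubalgebra_topologicalClosure_eq_top_of_separatesPoints S ?_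
      rintro ⟨i, x⟩ ⟨j, y⟩ hne
      by_cases h : i = j
      · obtain ⟨n, hxy⟩ : ∃ n, x n ≠ y n := by
          by_contra! h'
          exact hne (Prod.ext h (funext h'))
        refine ⟨_, ⟨siteVar E n (Pi.single (x n) 1), ?_, rfl⟩, ?_⟩
        · exact (hm' n _).trans (hn' n _).symm
        · simp [siteVar, Pi.single_apply, hxy.symm]
      · refine ⟨_, ⟨sysVar G (Pi.single i 1), ?_, rfl⟩, ?_⟩
        · exact (hm _).trans (hn _).symm
        · simp [sysVar, Pi.single_apply, Ne.symm h]
    have hcl : IsClosed (S : Set C(E × (ℤ → G), ℂ)) := by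
      have c1 : Continuous m :=
        AddMonoidHomClass.continuous_of_bound m 1 fun F => by
          simpa using NonUnitalStarAlgHom.norm_apply_le m F
      have c2 : Continuous m' :=
        AddMonoidHomClass.continuous_of_bound m' 1 fun F => by
          simpa using NonUnitalStarAlgHom.norm_apply_le m' F
      exact isClosed_eq c1 c2
    have : S = ⊤ := by
      rw [← hS]
      exact (SetLike.coe_injective (by
        rw [StarSubalgebra.topologicalClosure_coe, hcl.closure_eq])).symm
    ext F
    have hF : F ∈ S := this ▸ StarSubalgebra.mem_top
    exact hF

end Gelfand

/-! ### Classical dilations -/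

section Classical

variable {E G : Type}

/-- The one-step coupling `φ` between the system and the environment component `G_1`. -/
def coupling₁ (φ : E × G ≃ E × G) (ω : E × (ℤ → G)) : E × (ℤ → G) :=
  ((φ (ω.1, ω.2 1)).1, Function.update ω.2 1 (φ (ω.1, ω.2 1)).2)

/-- The left shift `ϑ`, extended to `E × G^ℤ`. -/
def leftShift (ω : E × (ℤ → G)) : E × (ℤ → G) := (ω.1, fun n => ω.2 (n + 1))

/-- The global evolution `α = ϑ ∘ φ_1`. -/
def globalMap (φ : E × G ≃ E × G) (ω : E × (ℤ → G)) : E × (ℤ → G) := leftShift (coupling₁ φ ω)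

/-- `α` as a continuous map of the compact space `E × G^ℤ`. -/
def globalCont [TopologicalSpace E] [DiscreteTopology E] [TopologicalSpace G] [DiscreteTopology G]
    (φ : E × G ≃ E × G) : C(E × (ℤ → G), E × (ℤ → G)) where
  toFun := globalMap φ
  continuous_toFun := by
    have h0 : Continuous fun ω : E × (ℤ → G) => φ (ω.1, ω.2 1) :=
      (continuous_of_discreteTopology (f := φ)).comp
        (continuous_fst.prodMk ((continuous_apply 1).comp continuous_snd))
    have h1 : Continuous (coupling₁ φ) :=
      (continuous_fst.comp h0).prodMk (continuous_snd.update 1 (continuous_snd.comp h0))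
    exact (continuous_fst.comp h1).prodMk
      (continuous_pi fun n => (continuous_apply (n + 1)).comp (continuous_snd.comp h1))

variable [MeasurableSpace E] [MeasurableSpace G]

/-- `(Ω, ℱ, (ℱ_t), (X_t), (μ_k))` is a homogeneous Markov chain with transition matrix `P`. -/
structure IsMarkovChain {Ω : Type} {mΩ : MeasurableSpace Ω} (ℱ : Filtration ℕ mΩ)
    (X : ℕ → Ω → E) (μ : E → Measure Ω) (P : Matrix E E ℝ) : Prop where
  adapted : ∀ t, Measurable[ℱ t] (X t)
  initial : ∀ k, (μ k).map (X 0) = Measure.dirac k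
  markov : ∀ k t j, condExp (ℱ t) (μ k) ((X (t + 1) ⁻¹' {j}).indicator fun _ => (1 : ℝ))
    =ᵐ[μ k] fun ω => P (X t ω) j
  markov' : ∀ k t j, condExp (MeasurableSpace.comap (X t) inferInstance) (μ k)
    ((X (t + 1) ⁻¹' {j}).indicator fun _ => (1 : ℝ)) =ᵐ[μ k] fun ω => P (X t ω) j

/-- The filtration `ℱ_t = σ(X_0, Y_s; 1 ≤ s ≤ t)` on `E × G^ℤ`. -/
def dilationFiltration (E G : Type) [MeasurableSpace E] [MeasurableSpace G] :
    Filtration ℕ (inferInstance : MeasurableSpace (E × (ℤ → G))) where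
  seq t := MeasurableSpace.comap (fun ω : E × (ℤ → G) => ω.1) inferInstance ⊔
    ⨆ s ∈ Finset.Icc 1 t, MeasurableSpace.comap (fun ω : E × (ℤ → G) => ω.2 (s : ℤ)) inferInstance
  mono' _ _ h := sup_le_sup le_rfl
    (biSup_mono fun _ hs => Finset.Icc_subset_Icc_right h hs)
  le' _ := sup_le (measurable_fst.comap_le) (iSup₂_le fun s _ =>
    ((measurable_pi_apply (s : ℤ)).comp measurable_snd).comap_le)

/-- `δ_k ⊗ q^{⊗ℤ}`. -/
def dilationMeasure (q : Measure G) (k : E) : Measure (E × (ℤ → G)) :=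
  (Measure.dirac k).prod (Measure.infinitePi fun _ : ℤ => q)

/-- `(G, φ, q^{⊗ℤ})` is a standard dilation of the Markov semigroup `P^t`: the process
`X_t = X_0 ∘ α^t` is a Markov chain with transition matrix `P`. -/
def IsStandardDilation (P : Matrix E E ℝ) (φ : E × G ≃ E × G) (q : Measure G) : Prop :=
  IsMarkovChain (dilationFiltration E G) (fun t ω => ((globalMap φ)^[t] ω).1)
    (dilationMeasure q) P

end Classical

/-! ### Operators on `L²` of finite sets -/

section Finite

/-- `L²(μ_S)` of a finite set `S` with uniform probability `μ_S`, in coordinates with respect to its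
canonical orthonormal basis `{|i⟩}`. -/
abbrev L2 (S : Type) [Fintype S] : Type := EuclideanSpace ℂ S

/-- Bounded operators. -/
abbrev Op (H : Type) [NormedAddCommGroup H] [InnerProductSpace ℂ H] : Type := H →L[ℂ] H

variable {S K E G : Type} [Fintype S] [DecidableEq S] [Fintype K] [DecidableEq K]
  [Fintype E] [DecidableEq E] [Fintype G] [DecidableEq G]

/-- `|i⟩`. -/
def ket (i : S) : L2 S := EuclideanSpace.single i 1

/-- `|i⟩⟨j|`. -/
def ketbra (i j : S) : Op (L2 S) := InnerProductSpace.rankOne ℂ (ket i) (ket j)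

/-- The operator with the given matrix in the canonical basis. -/
def opOfMat (M : Matrix S S ℂ) : Op (L2 S) := Matrix.toEuclideanCLM (𝕜 := ℂ) M

/-- The matrix `⟨i|X|j⟩`. -/
def matOfOp (X : Op (L2 S)) : Matrix S S ℂ := fun i j => ⟪ket i, X (ket j)⟫_ℂ

/-- `f ↦ m_f`, the multiplication operators on `L²(μ_S)`. -/
def finMul (S : Type) [Fintype S] [DecidableEq S] : (S → ℂ) →⋆ₐ[ℂ] Op (L2 S) where
  toFun f := opOfMat (Matrix.diagonal f)
  map_one' := by simp [opOfMat]
  map_mul' f g := by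
    rw [opOfMat, opOfMat, opOfMat, ← map_mul, Matrix.diagonal_mul_diagonal]; rfl
  map_zero' := by simp [opOfMat]
  map_add' f g := by
    rw [opOfMat, opOfMat, opOfMat, ← map_add, Matrix.diagonal_add]; rfl
  commutes' r := by
    have : Matrix.diagonal (algebraMap ℂ (S → ℂ) r) = algebraMap ℂ (Matrix S S ℂ) r := rfl
    rw [this, opOfMat, AlgHomClass.commutes]
  map_star' f := by
    rw [opOfMat, opOfMat, ← map_star, Matrix.star_eq_conjTranspose, Matrix.diagonal_conjTranspose]

/-- `h ↦ h ⊗ κ`. -/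
def tensVec (S : Type) [Fintype S] (κ : L2 K) : L2 S →L[ℂ] L2 (S × K) :=
  LinearMap.toContinuousLinearMap
    { toFun := fun h => WithLp.toLp 2 fun p => h p.1 * κ p.2
      map_add' := fun h k => by ext p; simp [add_mul]
      map_smul' := fun c h => by ext p; simp [mul_assoc] }

/-- The conditional expectation `B(L²(S) ⊗ L²(K)) → B(L²(S))` with respect to the trace class
operator `|κ⟩⟨κ'|`: `⟨h, E[X] k⟩ = ⟨h ⊗ κ', X (k ⊗ κ)⟩`. -/
def condExpVec (κ κ' : L2 K) (X : Op (L2 (S × K))) : Op (L2 S) :=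
  (tensVec S κ').adjoint ∘L X ∘L tensVec S κ

/-- `a ⊗ 1`. -/
def ampl (K : Type) [Fintype K] [DecidableEq K] (a : Op (L2 S)) : Op (L2 (S × K)) :=
  opOfMat (Matrix.kroneckerMap (· * ·) (matOfOp a) (1 : Matrix K K ℂ))

/-- `κ^{⊗t}`. -/
def tensPow (t : ℕ) (κ : L2 G) : L2 (Fin t → G) := WithLp.toLp 2 fun x => ∏ s, κ (x s)

/-- `X ⊗ b` for `X ∈ B(L²(E) ⊗ L²(G)^{⊗t})` and `b` acting on the factor `t + 1`. -/
def appendSite {t : ℕ} (X : Op (L2 (E × (Fin t → G)))) (b : Op (L2 G)) :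
    Op (L2 (E × (Fin (t + 1) → G))) :=
  opOfMat (Matrix.of fun p r => matOfOp X (p.1, fun s => p.2 s.castSucc)
    (r.1, fun s => r.2 s.castSucc) * matOfOp b (p.2 (Fin.last t)) (r.2 (Fin.last t)))

/-- The quantum stochastic flow `j_t : B(H) → B(H ⊗ Z_1 ⊗ ⋯ ⊗ Z_t)`. -/
def flow (V : Op (L2 (E × G))) : (t : ℕ) → Op (L2 E) → Op (L2 (E × (Fin t → G)))
  | 0, a => ampl (Fin 0 → G) a
  | t + 1, a => ∑ z : G, ∑ z' : G,
      appendSite (flow V t (condExpVec (ket z) (ket z') (star V * ampl G a * V))) (ketbra z' z)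

/-- The operator `X_n`, for `X ∈ B(H ⊗ Z)`, acting on `H` and on the factor `Z_n` of
`H ⊗ ⨂ Z_n`. -/
def embedSite (ψ : UnitVec (L2 G)) (n : ℤ) (X : Op (L2 (E × G))) : Op (HK (L2 E) ψ) :=
  ∑ p : E × G, ∑ r : E × G, matOfOp X p r •
    (sysHom ψ (ketbra p.1 r.1) * siteHom (L2 E) ψ n (ketbra p.2 r.2))

/-- `J(A) = V_1* Θ̂(A) V_1` with `Θ̂(A) = Θ* A Θ`; that is `J(A) = U* A U`, `U = Θ V_1`. -/
def dynJ (ψ : UnitVec (L2 G)) (V : Op (L2 (E × G))) (A : Op (HK (L2 E) ψ)) : Op (HK (L2 E) ψ) :=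
  star (embedSite ψ 1 V) * (star (shiftOp (L2 E) ψ) * A * shiftOp (L2 E) ψ) * embedSite ψ 1 V

theorem existsUnique_globalMul [TopologicalSpace E] [DiscreteTopology E] [TopologicalSpace G]
    [DiscreteTopology G] (ψ : UnitVec (L2 G)) :
    ∃! m : C(E × (ℤ → G), ℂ) →⋆ₐ[ℂ] Op (HK (L2 E) ψ),
      (∀ f, m (sysVar G f) = ((sysHom ψ).comp (finMul E)) f) ∧
      ∀ n f, m (siteVar E n f) = ((siteHom (L2 E) ψ n).comp (finMul G)) f :=
  existsUnique_tensorHom _ (fun n => (siteHom (L2 E) ψ n).comp (finMul G))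
    (fun _ _ _ => sysHom_commute _ _ _) (fun _ _ h _ _ => siteHom_commute h _ _)

/-- The *-homomorphism `F ↦ m_F` from `C(E × G^ℤ) = L^∞(E) ⊗ ⨂ L^∞(G_n)` to
`B(H ⊗ ⨂ Z_n)`: the unique one that is `f ↦ m_f` on each tensor factor. -/
def globalMul [TopologicalSpace E] [DiscreteTopology E] [TopologicalSpace G]
    [DiscreteTopology G] (ψ : UnitVec (L2 G)) : C(E × (ℤ → G), ℂ) →⋆ₐ[ℂ] Op (HK (L2 E) ψ) :=
  (existsUnique_globalMul ψ).choose

/-- `V = ∑ |φ(i,g)⟩⟨i,g|`. -/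
def unitaryV (φ : E × G ≃ E × G) : Op (L2 (E × G)) :=
  ∑ p : E × G, InnerProductSpace.rankOne ℂ (ket (φ p)) (ket p)

/-- `V_{gg'} = ∑_{ij} |i⟩⟨i,g|φ(j,g')⟩⟨j|`. -/
def blockV (φ : E × G ≃ E × G) (g g' : G) : Op (L2 E) :=
  ∑ i : E, ∑ j : E, ⟪ket (i, g), ket (φ (j, g'))⟫_ℂ • ketbra i j

/-- `∑_{g'} √q_{g'} V_{gg'}`. -/
def krausV [MeasurableSpace G] (φ : E × G ≃ E × G) (q : Measure G) (g : G) : Op (L2 E) :=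
  ∑ g' : G, ((√(q.real {g'}) : ℝ) : ℂ) • blockV φ g g'

/-- `T a = ∑_g (∑_{g'} √q_{g'} V_{gg'})^* a (∑_{g''} √q_{g''} V_{gg''})`. -/
def qdsMap [MeasurableSpace G] (φ : E × G ≃ E × G) (q : Measure G) :
    Module.End ℂ (Op (L2 E)) where
  toFun a := ∑ g : G, star (krausV φ q g) * a * krausV φ q g
  map_add' a b := by simp [mul_add, add_mul, Finset.sum_add_distrib]
  map_smul' c a := by simp [Finset.smul_sum]

/-- `υ = ∑_g √q_g |g⟩`. -/
def upsilon [MeasurableSpace G] [DiscreteMeasurableSpace G] (q : Measure G)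
    [IsProbabilityMeasure q] : UnitVec (L2 G) :=
  ⟨∑ g : G, ((√(q.real {g}) : ℝ) : ℂ) • ket g, by
    have h : ∑ g : G, q.real {g} = 1 := by
      rw [sum_measureReal_singleton]; simp
    have h2 : (∑ g : G, ((√(q.real {g}) : ℝ) : ℂ) • ket g : L2 G)
        = WithLp.toLp 2 fun g => ((√(q.real {g}) : ℝ) : ℂ) := by
      ext g
      simp [ket, Pi.single_apply]
    rw [h2, EuclideanSpace.norm_eq]
    simp [Real.sq_sqrt measureReal_nonneg, h]⟩

end Finite

/-! ### Quantum dynamical semigroups and their dilations -/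

section Quantum

variable {H : Type} [NormedAddCommGroup H] [InnerProductSpace ℂ H]

/-- The ultraweak topology on `B(H)`. -/
abbrev ultraweak (H : Type) [NormedAddCommGroup H] [InnerProductSpace ℂ H] :
    TopologicalSpace (Op H) :=
  ⨅ (x : lp (fun _ : ℕ => H) 2) (y : lp (fun _ : ℕ => H) 2),
    TopologicalSpace.induced (fun a : Op H => ∑' n, ⟪x n, a (y n)⟫_ℂ) inferInstance

/-- Stochastic maps on `B(H)`: the generators `T` of quantum dynamical semigroups `T^t`. -/
structure IsStochasticMap [CompleteSpace H] (T : Module.End ℂ (Op H)) : Prop where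
  bounded : Continuous T
  completelyPositive : ∀ (k : ℕ) (M : CStarMatrix (Fin k) (Fin k) (Op H)), 0 ≤ M → 0 ≤ M.map T
  normal : Continuous[ultraweak H, ultraweak H] T
  unital : T 1 = 1

/-- `B` has trace `c`: in every orthonormal basis the diagonal sums to `c`. -/
def HasTrace (B : Op H) (c : ℂ) : Prop :=
  ∀ (ι : Type) (b : HilbertBasis ι ℂ H), HasSum (fun i => ⟪b i, B (b i)⟫_ℂ) c

variable {E G : Type} [Fintype E] [DecidableEq E] [Fintype G] [DecidableEq G]

/-- `T^t` extends the classical semigroup `P^t`: `T m_f = m_{Pf}`. -/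
def ExtendsMarkov (T : Module.End ℂ (Op (L2 E))) (P : Matrix E E ℝ) : Prop :=
  ∀ f : E → ℂ, T (finMul E f) = finMul E fun i => ∑ j, (P i j : ℂ) * f j

/-- `(Z, V, υ)`, `Z = L²(μ_G)`, is a QP-dilation of the quantum dynamical semigroup `T^t`. -/
structure IsQPDilation (V : Op (L2 (E × G))) (υ : UnitVec (L2 G))
    (T : Module.End ℂ (Op (L2 E))) : Prop where
  unitary : V ∈ unitary (Op (L2 (E × G)))
  stochastic : IsStochasticMap T
  eq_flow : ∀ (t : ℕ) (a : Op (L2 E)),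
    (T ^ t) a = condExpVec (tensPow t υ.1) (tensPow t υ.1) (flow V t a)
  eq_group : ∀ (t : ℕ) (a : Op (L2 E)),
    (T ^ t) a = condExpVac υ ((dynJ υ V)^[t] (sysHom υ a))

end Quantum

end QPD

end

/-! The dynamics `dynJ` is conjugation by the unitary U = Θ V₁. The shift moves every environment
factor by one site and V₁ itself lies in `globalAlg`, so conjugation by U and by U* both preserve
the algebra and J restricts to an automorphism.

Since V permutes the canonical basis by φ, V* m_h V = m_{h∘φ}. Hence the *-homomorphisms F ↦ J(m_F)
and F ↦ m_{F∘α} agree on functions of a single coordinate, and a *-homomorphism on C(E × G^ℤ) is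
determined by those (`globalMul_comp_globalCont`).

For the expectations, a *-homomorphism intertwines functional calculi, so η(m_{F₁}, …) = m_{η(F₁,
…)}. It remains to identify the vector state of |k⟩ ⊗ υ^{⊗ℤ} on the operators m_F. It is a product
functional whose one-site marginal is q, because the amplitudes of υ are √q; by density of cylinder
functions it is integration against δ_k ⊗ q^{⊗ℤ} (`inner_vac_globalMul`).

For the semigroup, T a = E_υ[V*(a ⊗ 1)V] (`qdsMap_eq_condExpVec`), and the operators in its
definition are the slices ⟨g|V|υ⟩. The Kraus form makes T stochastic. For the dilation, J(a) is a
sum of products of system operators with |z'⟩⟨z| at site 1. J^t sends site 1 to site t + 1, which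
commutes with J^t(B(H)), so the vacuum expectation factors and the powers of T appear by induction;
the flow satisfies the same recursion. Finally, the Markov property at time 0 says P_{ij} = q{g :
φ^E(i,g) = j}, and this average is what T computes on m_f. -/

namespace QPD

/-! ### Operators on L² of a finite set through their matrices -/

section MatrixUnits

variable {S K : Type} [Fintype S] [DecidableEq S] [Fintype K] [DecidableEq K]

theorem ket_apply (i j : S) : ket i j = if j = i then 1 else 0 := by
  simp [ket]

theorem inner_ket_left (i : S) (v : L2 S) : ⟪ket i, v⟫_ℂ = v i := by
  simp [ket, EuclideanSpace.inner_single_left]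

theorem inner_ket_right (i : S) (v : L2 S) : ⟪v, ket i⟫_ℂ = star (v i) := by
  simp [ket, EuclideanSpace.inner_single_right]

theorem opOfMat_apply (M : Matrix S S ℂ) (v : L2 S) (i : S) :
    opOfMat M v i = ∑ j, M i j * v j := by
  simp [opOfMat, Matrix.ofLp_toEuclideanCLM, Matrix.mulVec, dotProduct]

theorem matOfOp_opOfMat (M : Matrix S S ℂ) : matOfOp (opOfMat M) = M := by
  ext i j
  simp [matOfOp, inner_ket_left, opOfMat_apply, ket_apply]

theorem opOfMat_matOfOp (X : Op (L2 S)) : opOfMat (matOfOp X) = X := by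
  obtain ⟨M, rfl⟩ : ∃ M, opOfMat M = X := (Matrix.toEuclideanCLM (n := S) (𝕜 := ℂ)).surjective X
  rw [matOfOp_opOfMat]

/-- This reduces operator identities to identities of matrix entries, the form in which `ampl`,
`condExpVec` and `appendSite` are computable. -/
theorem matOfOp_injective : Function.Injective (matOfOp (S := S)) :=
  Function.LeftInverse.injective opOfMat_matOfOp

theorem matOfOp_mul (X Y : Op (L2 S)) : matOfOp (X * Y) = matOfOp X * matOfOp Y := by
  conv_lhs => rw [← opOfMat_matOfOp X, ← opOfMat_matOfOp Y, opOfMat, opOfMat, ← map_mul]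
  exact matOfOp_opOfMat _

theorem matOfOp_star (X : Op (L2 S)) : matOfOp (star X) = star (matOfOp X) := by
  conv_lhs => rw [← opOfMat_matOfOp X, opOfMat, ← map_star]
  exact matOfOp_opOfMat _

theorem matOfOp_one : matOfOp (1 : Op (L2 S)) = 1 := by
  rw [← map_one (Matrix.toEuclideanCLM (n := S) (𝕜 := ℂ))]
  exact matOfOp_opOfMat _

theorem matOfOp_ketbra (i j : S) : matOfOp (ketbra i j) = Matrix.single i j 1 := by
  ext k l
  rw [matOfOp, inner_ket_left, ketbra, InnerProductSpace.rankOne_apply, inner_ket_left,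
    PiLp.smul_apply, smul_eq_mul, ket_apply, ket_apply, Matrix.single_apply]
  grind

theorem matOfOp_finMul (f : S → ℂ) : matOfOp (finMul S f) = Matrix.diagonal f :=
  matOfOp_opOfMat _

theorem matOfOp_sum {ι : Type} (s : Finset ι) (X : ι → Op (L2 S)) :
    matOfOp (∑ x ∈ s, X x) = ∑ x ∈ s, matOfOp (X x) := by
  ext i j
  simp [matOfOp, Matrix.sum_apply]

theorem matOfOp_smul (c : ℂ) (X : Op (L2 S)) : matOfOp (c • X) = c • matOfOp X := by
  ext i j
  simp [matOfOp]

theorem matOfOp_ampl (a : Op (L2 S)) :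
    matOfOp (ampl K a) = Matrix.kroneckerMap (· * ·) (matOfOp a) (1 : Matrix K K ℂ) :=
  matOfOp_opOfMat _

theorem sum_ketbra (X : Op (L2 S)) : ∑ i, ∑ j, matOfOp X i j • ketbra i j = X := by
  apply matOfOp_injective
  simp only [matOfOp_sum, matOfOp_smul, matOfOp_ketbra]
  conv_rhs => rw [Matrix.matrix_eq_sum_single (matOfOp X)]
  simp [Matrix.smul_single]

theorem ketbra_mul_ketbra (i j k l : S) :
    ketbra i j * ketbra k l = if j = k then ketbra i l else 0 := by
  apply matOfOp_injective
  rw [matOfOp_mul, matOfOp_ketbra, matOfOp_ketbra]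
  split_ifs with h
  · subst h; simp [matOfOp_ketbra]
  · rw [Matrix.single_mul_single_of_ne _ _ _ _ h]; ext; simp [matOfOp]

theorem star_ketbra (i j : S) : star (ketbra i j) = ketbra j i := by
  apply matOfOp_injective
  rw [matOfOp_star, matOfOp_ketbra, matOfOp_ketbra, Matrix.star_eq_conjTranspose]
  simp

theorem finMul_single (i : S) : finMul S (Pi.single i 1) = ketbra i i := by
  apply matOfOp_injective
  rw [matOfOp_finMul, matOfOp_ketbra, Matrix.diagonal_single]

end MatrixUnits

/-! ### The embedding of B(H ⊗ Z) at one site -/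

section EmbedSite

variable {E G : Type} [Fintype E] [DecidableEq E] [Fintype G] [DecidableEq G]

/-- The images of B(H) and B(Z_n) commute, so products of their matrix units obey the relations of
the matrix units |p⟩⟨r| of B(H ⊗ Z). Multiplicativity of `embedSite` follows. -/
theorem matrixUnit_mul (ψ : UnitVec (L2 G)) (n : ℤ) (p r s t : E × G) :
    (sysHom ψ (ketbra p.1 r.1) * siteHom (L2 E) ψ n (ketbra p.2 r.2)) *
      (sysHom ψ (ketbra s.1 t.1) * siteHom (L2 E) ψ n (ketbra s.2 t.2)) =
    if r = s then sysHom ψ (ketbra p.1 t.1) * siteHom (L2 E) ψ n (ketbra p.2 t.2) else 0 := by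
  rw [mul_assoc, ← mul_assoc (siteHom (L2 E) ψ n (ketbra p.2 r.2)),
    ← (sysHom_commute (ketbra s.1 t.1) n (ketbra p.2 r.2)).eq, mul_assoc, ← map_mul, ← mul_assoc,
    ← map_mul, ketbra_mul_ketbra, ketbra_mul_ketbra]
  by_cases h1 : r.1 = s.1 <;> by_cases h2 : r.2 = s.2 <;> simp [h1, h2, Prod.ext_iff]

theorem embedSite_mul (ψ : UnitVec (L2 G)) (n : ℤ) (X Y : Op (L2 (E × G))) :
    embedSite ψ n (X * Y) = embedSite ψ n X * embedSite ψ n Y := by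
  simp only [embedSite, matOfOp_mul]
  rw [Finset.sum_mul]
  refine Finset.sum_congr rfl fun p _ => ?_
  rw [Finset.sum_mul_sum]
  simp only [Finset.mul_sum, smul_mul_smul_comm, matrixUnit_mul, Matrix.mul_apply, Finset.sum_smul]
  rw [Finset.sum_comm]
  refine Finset.sum_congr rfl fun r _ => ?_
  simp

theorem embedSite_star (ψ : UnitVec (L2 G)) (n : ℤ) (X : Op (L2 (E × G))) :
    embedSite ψ n (star X) = star (embedSite ψ n X) := by
  simp only [embedSite, matOfOp_star, star_sum, star_smul, star_mul, ← map_star, star_ketbra,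
    Matrix.star_apply]
  rw [Finset.sum_comm]
  simp only [(sysHom_commute _ _ _).eq]

theorem embedSite_of_matOfOp (ψ : UnitVec (L2 G)) (n : ℤ) (a : Op (L2 E)) (b : Op (L2 G))
    {X : Op (L2 (E × G))} (h : ∀ p r, matOfOp X p r = matOfOp a p.1 r.1 * matOfOp b p.2 r.2) :
    embedSite ψ n X = sysHom ψ a * siteHom (L2 E) ψ n b := by
  conv_rhs => rw [← sum_ketbra a, ← sum_ketbra b]
  simp only [embedSite, h, Fintype.sum_prod_type, map_sum, map_smul, Finset.sum_mul_sum,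
    smul_mul_smul_comm]

theorem embedSite_ampl (ψ : UnitVec (L2 G)) (n : ℤ) (a : Op (L2 E)) :
    embedSite ψ n (ampl G a) = sysHom ψ a := by
  rw [embedSite_of_matOfOp ψ n a 1, map_one, mul_one]
  intro p r
  rw [matOfOp_ampl, matOfOp_one]; rfl

theorem embedSite_one (ψ : UnitVec (L2 G)) (n : ℤ) : embedSite (E := E) ψ n 1 = 1 := by
  rw [embedSite_of_matOfOp ψ n 1 1, map_one, map_one, mul_one]
  intro p r
  simp only [matOfOp_one, Matrix.one_apply, Prod.ext_iff]
  split_ifs <;> grind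

end EmbedSite
-- Unitary conjugation and generated C*-algebras
section CStar

variable {A B : Type} [CStarAlgebra A] [CStarAlgebra B]

theorem starAlgHom_continuous (f : A →⋆ₐ[ℂ] B) : Continuous f :=
  AddMonoidHomClass.continuous_of_bound f 1 fun x => by
    simpa using NonUnitalStarAlgHom.norm_apply_le f x

/-- A *-homomorphism that maps generators into a closed *-subalgebra maps the generated
C*-algebra into it. -/
theorem genAlg_le_comap (f : A →⋆ₐ[ℂ] B) (s : Set A) (S : StarSubalgebra ℂ B)
    (hS : IsClosed (S : Set B)) (h : ∀ a ∈ s, f a ∈ S) : genAlg s ≤ S.comap f :=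
  StarSubalgebra.topologicalClosure_minimal
    (StarAlgebra.adjoin_le h) (hS.preimage (starAlgHom_continuous f))

/-- The *-homomorphism `a ↦ u* a u`. -/
def unitaryConj (u : unitary A) : A →⋆ₐ[ℂ] A where
  toFun a := star (u : A) * a * u
  map_one' := by simp
  map_mul' a b := by
    have h : (u : A) * star (u : A) = 1 := Unitary.mul_star_self_of_mem u.2
    calc star (u : A) * (a * b) * u = star (u : A) * a * 1 * b * u := by simp only [mul_one, mul_assoc]
      _ = star (u : A) * a * u * (star (u : A) * b * u) := by rw [← h]; simp only [mul_assoc]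
  map_zero' := by simp
  map_add' a b := by simp [mul_add, add_mul]
  commutes' r := by simp [Algebra.algebraMap_eq_smul_one]
  map_star' a := by simp [mul_assoc]

theorem unitaryConj_apply (u : unitary A) (a : A) : unitaryConj u a = star (u : A) * a * u := rfl

theorem unitaryConj_star_unitaryConj (u : unitary A) (a : A) :
    unitaryConj (star u) (unitaryConj u a) = a := by
  have h : (u : A) * star (u : A) = 1 := Unitary.mul_star_self_of_mem u.2
  simp only [unitaryConj_apply, Unitary.coe_star, star_star]
  rw [← mul_assoc, ← mul_assoc, h, one_mul, mul_assoc, h, mul_one]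

/-- Conjugation by a unitary that normalizes a *-subalgebra is an automorphism of it. -/
theorem exists_starAlgEquiv_unitaryConj (S : StarSubalgebra ℂ A) (u : unitary A)
    (h1 : ∀ a ∈ S, unitaryConj u a ∈ S) (h2 : ∀ a ∈ S, unitaryConj (star u) a ∈ S) :
    ∃ J : S ≃⋆ₐ[ℂ] S, ∀ a, (J a : A) = unitaryConj u a :=
  ⟨{ toFun := fun a => ⟨unitaryConj u a, h1 a a.2⟩
     invFun := fun a => ⟨unitaryConj (star u) a, h2 a a.2⟩
     left_inv := fun a => Subtype.ext (unitaryConj_star_unitaryConj u a)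
     right_inv := fun a => Subtype.ext (by
       simpa using unitaryConj_star_unitaryConj (star u) (a : A))
     map_mul' := fun a b => Subtype.ext (map_mul (unitaryConj u) a.1 b.1)
     map_add' := fun a b => Subtype.ext (map_add (unitaryConj u) a.1 b.1)
     map_star' := fun a => Subtype.ext (map_star (unitaryConj u) a.1)
     map_smul' := fun c a => Subtype.ext (map_smul (unitaryConj u) c a.1) }, fun _ => rfl⟩

end CStar

/-! ### The shift as a unitary and its action on the tensor factors -/

section Shift

set_option linter.unusedSectionVars false

variable {H Z : Type} [NormedAddCommGroup H] [InnerProductSpace ℂ H] [CompleteSpace H]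
  [NormedAddCommGroup Z] [InnerProductSpace ℂ Z] [CompleteSpace Z] {ψ : UnitVec Z}

theorem TailSeq.shift_surjective : Function.Surjective (TailSeq.shift (ψ := ψ)) := fun z =>
  ⟨⟨fun n => z.1 (n - 1), z.2.preimage (sub_left_injective (b := (1 : ℤ))).injOn⟩,
    Subtype.ext (funext fun n => by simp [TailSeq.shift])⟩

theorem TailSeq.set_shift (z : TailSeq ψ) (n : ℤ) (v : Z) :
    z.shift.set n v = (z.set (n + 1) v).shift :=
  Subtype.ext (funext fun m => by simp [TailSeq.set, TailSeq.shift, Function.update_apply])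

theorem star_shiftOp_mul : star (shiftOp H ψ) * shiftOp H ψ = 1 :=
  ext_tens fun w l => eq_of_inner_tens fun z k => by
    change ⟪tens z k, star (shiftOp H ψ) (shiftOp H ψ (tens w l))⟫_ℂ = ⟪tens z k, tens w l⟫_ℂ
    rw [ContinuousLinearMap.star_eq_adjoint, ContinuousLinearMap.adjoint_inner_right,
      shiftOp_tens, shiftOp_tens, tens_inner, tens_inner, tailInner_shift]

/-- Every elementary tensor is the shift of another one, and on the range of Θ the identity follows
from Θ*Θ = 1. -/
theorem shiftOp_mul_star : shiftOp H ψ * star (shiftOp H ψ) = 1 :=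
  ext_tens fun w l => by
    obtain ⟨z, rfl⟩ := w.shift_surjective
    have h := congrArg (fun A => A (tens z l)) (star_shiftOp_mul (H := H) (ψ := ψ))
    change star (shiftOp H ψ) (shiftOp H ψ (tens z l)) = tens z l at h
    change shiftOp H ψ (star (shiftOp H ψ) (tens z.shift l)) = tens z.shift l
    rw [← shiftOp_tens, h]

theorem shiftOp_mem_unitary : shiftOp H ψ ∈ unitary (HK H ψ →L[ℂ] HK H ψ) :=
  ⟨star_shiftOp_mul, shiftOp_mul_star⟩

theorem sysHom_mul_shiftOp (a : H →L[ℂ] H) :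
    sysHom ψ a * shiftOp H ψ = shiftOp H ψ * sysHom ψ a :=
  ext_tens fun z k => by
    change sysOp ψ a (shiftOp H ψ (tens z k)) = shiftOp H ψ (sysOp ψ a (tens z k))
    simp [sysOp_tens, shiftOp_tens]

/-- Site n of a shifted sequence is site n + 1 of the original, so A ↦ Θ* A Θ raises the site by
one; in particular it brings Z_0 to the coupling site 1. -/
theorem siteHom_mul_shiftOp (n : ℤ) (b : Z →L[ℂ] Z) :
    siteHom H ψ n b * shiftOp H ψ = shiftOp H ψ * siteHom H ψ (n + 1) b :=
  ext_tens fun z k => by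
    change siteOp H ψ n b (shiftOp H ψ (tens z k)) = shiftOp H ψ (siteOp H ψ (n + 1) b (tens z k))
    rw [siteOp_tens, shiftOp_tens, shiftOp_tens, siteOp_tens, TailSeq.set_shift]
    rfl

theorem star_shiftOp_sysHom_shiftOp (a : H →L[ℂ] H) :
    star (shiftOp H ψ) * sysHom ψ a * shiftOp H ψ = sysHom ψ a := by
  rw [mul_assoc, sysHom_mul_shiftOp, ← mul_assoc, star_shiftOp_mul, one_mul]

theorem star_shiftOp_siteHom_shiftOp (n : ℤ) (b : Z →L[ℂ] Z) :
    star (shiftOp H ψ) * siteHom H ψ n b * shiftOp H ψ = siteHom H ψ (n + 1) b := by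
  rw [mul_assoc, siteHom_mul_shiftOp, ← mul_assoc, star_shiftOp_mul, one_mul]

theorem shiftOp_sysHom_star_shiftOp (a : H →L[ℂ] H) :
    shiftOp H ψ * sysHom ψ a * star (shiftOp H ψ) = sysHom ψ a := by
  rw [← sysHom_mul_shiftOp, mul_assoc, shiftOp_mul_star, mul_one]

theorem shiftOp_siteHom_star_shiftOp (n : ℤ) (b : Z →L[ℂ] Z) :
    shiftOp H ψ * siteHom H ψ n b * star (shiftOp H ψ) = siteHom H ψ (n - 1) b := by
  have h := siteHom_mul_shiftOp (H := H) (ψ := ψ) (n - 1) b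
  rw [sub_add_cancel] at h
  rw [← h, mul_assoc, shiftOp_mul_star, mul_one]

theorem isClosed_globalAlg : IsClosed (globalAlg H ψ : Set (HK H ψ →L[ℂ] HK H ψ)) :=
  isClosed_closure

theorem sysHom_mem_globalAlg (a : H →L[ℂ] H) : sysHom ψ a ∈ globalAlg H ψ :=
  mem_genAlg (Or.inl ⟨a, rfl⟩)

theorem siteHom_mem_globalAlg (n : ℤ) (b : Z →L[ℂ] Z) : siteHom H ψ n b ∈ globalAlg H ψ :=
  mem_genAlg (Or.inr (Set.mem_iUnion.2 ⟨n, b, rfl⟩))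

/-- A *-endomorphism that preserves all tensor factors up to `globalAlg` preserves `globalAlg`. -/
theorem map_mem_globalAlg (f : (HK H ψ →L[ℂ] HK H ψ) →⋆ₐ[ℂ] (HK H ψ →L[ℂ] HK H ψ))
    (h1 : ∀ a, f (sysHom ψ a) ∈ globalAlg H ψ)
    (h2 : ∀ n b, f (siteHom H ψ n b) ∈ globalAlg H ψ) {A : HK H ψ →L[ℂ] HK H ψ}
    (hA : A ∈ globalAlg H ψ) : f A ∈ globalAlg H ψ := by
  refine genAlg_le_comap f _ (globalAlg H ψ) isClosed_globalAlg ?_ hA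
  rintro _ (⟨a, rfl⟩ | h)
  · exact h1 a
  · obtain ⟨n, b, rfl⟩ := Set.mem_iUnion.1 h
    exact h2 n b

end Shift

/-! ### The automorphism J -/

section Dynamics

variable {E G : Type} [Fintype E] [DecidableEq E] [Fintype G] [DecidableEq G]

theorem embedSite_mem_globalAlg (ψ : UnitVec (L2 G)) (n : ℤ) (X : Op (L2 (E × G))) :
    embedSite ψ n X ∈ globalAlg (L2 E) ψ :=
  sum_mem fun _ _ => sum_mem fun _ _ => (globalAlg (L2 E) ψ).smul_mem
    (mul_mem (sysHom_mem_globalAlg _) (siteHom_mem_globalAlg _ _)) _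

theorem embedSite_mem_unitary (ψ : UnitVec (L2 G)) (n : ℤ) {V : Op (L2 (E × G))}
    (hV : V ∈ unitary (Op (L2 (E × G)))) :
    embedSite ψ n V ∈ unitary (Op (HK (L2 E) ψ)) := by
  constructor
  · rw [← embedSite_star, ← embedSite_mul, hV.1, embedSite_one]
  · rw [← embedSite_star, ← embedSite_mul, hV.2, embedSite_one]

/-- The unitary `U = Θ V_1` with `J(A) = U* A U`. -/
noncomputable def dynUnitary (ψ : UnitVec (L2 G)) {V : Op (L2 (E × G))}
    (hV : V ∈ unitary (Op (L2 (E × G)))) : unitary (Op (HK (L2 E) ψ)) :=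
  ⟨shiftOp (L2 E) ψ, shiftOp_mem_unitary⟩ * ⟨embedSite ψ 1 V, embedSite_mem_unitary ψ 1 hV⟩

theorem unitaryConj_dynUnitary (ψ : UnitVec (L2 G)) {V : Op (L2 (E × G))}
    (hV : V ∈ unitary (Op (L2 (E × G)))) (A : Op (HK (L2 E) ψ)) :
    unitaryConj (dynUnitary ψ hV) A = dynJ ψ V A := by
  simp [dynUnitary, dynJ, unitaryConj_apply, mul_assoc]

theorem unitaryConj_star_dynUnitary (ψ : UnitVec (L2 G)) {V : Op (L2 (E × G))}
    (hV : V ∈ unitary (Op (L2 (E × G)))) (A : Op (HK (L2 E) ψ)) :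
    unitaryConj (star (dynUnitary ψ hV)) A =
      shiftOp (L2 E) ψ * (embedSite ψ 1 V * A * star (embedSite ψ 1 V)) *
        star (shiftOp (L2 E) ψ) := by
  simp [dynUnitary, unitaryConj_apply, mul_assoc]

theorem dynJ_sysHom (ψ : UnitVec (L2 G)) (V : Op (L2 (E × G))) (a : Op (L2 E)) :
    dynJ ψ V (sysHom ψ a) = embedSite ψ 1 (star V * ampl G a * V) := by
  rw [dynJ, star_shiftOp_sysHom_shiftOp, embedSite_mul, embedSite_mul, embedSite_star,
    embedSite_ampl]

theorem embedSite_commute_siteHom (ψ : UnitVec (L2 G)) {m n : ℤ} (h : m ≠ n)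
    (X : Op (L2 (E × G))) (b : Op (L2 G)) :
    Commute (embedSite ψ m X) (siteHom (L2 E) ψ n b) :=
  Commute.sum_left _ _ _ fun _ _ => Commute.sum_left _ _ _ fun _ _ =>
    ((sysHom_commute _ _ _).mul_left (siteHom_commute h _ _)).smul_left _

theorem dynJ_siteHom_zero (ψ : UnitVec (L2 G)) (V : Op (L2 (E × G))) (b : Op (L2 G)) :
    dynJ ψ V (siteHom (L2 E) ψ 0 b) =
      star (embedSite ψ 1 V) * siteHom (L2 E) ψ 1 b * embedSite ψ 1 V := by
  rw [dynJ, star_shiftOp_siteHom_shiftOp, zero_add]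

/-- After the shift the operator sits at n + 1 ≠ 1, hence commutes with V₁, which cancels against
V₁*. Only site 0 meets the coupling. -/
theorem dynJ_siteHom (ψ : UnitVec (L2 G)) {V : Op (L2 (E × G))}
    (hV : V ∈ unitary (Op (L2 (E × G)))) {n : ℤ} (hn : n ≠ 0) (b : Op (L2 G)) :
    dynJ ψ V (siteHom (L2 E) ψ n b) = siteHom (L2 E) ψ (n + 1) b := by
  rw [dynJ, star_shiftOp_siteHom_shiftOp, mul_assoc,
    ← (embedSite_commute_siteHom ψ (by omega) V b).eq, ← mul_assoc,
    (embedSite_mem_unitary ψ 1 hV).1, one_mul]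

theorem unitaryConj_dynUnitary_mem_globalAlg (ψ : UnitVec (L2 G)) {V : Op (L2 (E × G))}
    (hV : V ∈ unitary (Op (L2 (E × G)))) (A : Op (HK (L2 E) ψ)) (hA : A ∈ globalAlg (L2 E) ψ) :
    unitaryConj (dynUnitary ψ hV) A ∈ globalAlg (L2 E) ψ := by
  have hmem := embedSite_mem_globalAlg (E := E) ψ 1 V
  refine map_mem_globalAlg (unitaryConj (dynUnitary ψ hV)) (fun a => ?_) (fun n b => ?_) hA
  · rw [unitaryConj_dynUnitary, dynJ_sysHom]
    exact embedSite_mem_globalAlg _ _ _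
  · rw [unitaryConj_dynUnitary, dynJ, star_shiftOp_siteHom_shiftOp]
    exact mul_mem (mul_mem (star_mem hmem) (siteHom_mem_globalAlg _ _)) hmem

/-- In the inverse, conjugation by V₁ comes first and stays in the algebra because V₁ belongs to it;
only the conjugation by Θ has to be checked on generators. -/
theorem unitaryConj_star_dynUnitary_mem_globalAlg (ψ : UnitVec (L2 G)) {V : Op (L2 (E × G))}
    (hV : V ∈ unitary (Op (L2 (E × G)))) (A : Op (HK (L2 E) ψ)) (hA : A ∈ globalAlg (L2 E) ψ) :
    unitaryConj (star (dynUnitary ψ hV)) A ∈ globalAlg (L2 E) ψ := by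
  have hmem := embedSite_mem_globalAlg (E := E) ψ 1 V
  let Θ : unitary (Op (HK (L2 E) ψ)) := ⟨shiftOp (L2 E) ψ, shiftOp_mem_unitary⟩
  have h : ∀ B, unitaryConj (star Θ) B = shiftOp (L2 E) ψ * B * star (shiftOp (L2 E) ψ) :=
    fun B => by simp [Θ, unitaryConj_apply]
  rw [unitaryConj_star_dynUnitary, ← h]
  refine map_mem_globalAlg (unitaryConj (star Θ)) (fun a => ?_) (fun n b => ?_)
    (mul_mem (mul_mem hmem hA) (star_mem hmem))
  · rw [h, shiftOp_sysHom_star_shiftOp]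
    exact sysHom_mem_globalAlg _
  · rw [h, shiftOp_siteHom_star_shiftOp]
    exact siteHom_mem_globalAlg _ _

theorem exists_starAlgEquiv_dynJ (ψ : UnitVec (L2 G)) {V : Op (L2 (E × G))}
    (hV : V ∈ unitary (Op (L2 (E × G)))) :
    ∃ J : globalAlg (L2 E) ψ ≃⋆ₐ[ℂ] globalAlg (L2 E) ψ,
      ∀ A, (J A : Op (HK (L2 E) ψ)) = dynJ ψ V A := by
  obtain ⟨J, hJ⟩ := exists_starAlgEquiv_unitaryConj (globalAlg (L2 E) ψ) (dynUnitary ψ hV)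
    (unitaryConj_dynUnitary_mem_globalAlg ψ hV) (unitaryConj_star_dynUnitary_mem_globalAlg ψ hV)
  exact ⟨J, fun A => (hJ A).trans (unitaryConj_dynUnitary ψ hV A)⟩

end Dynamics
-- The permutation unitary V
section Permutation

variable {E G : Type} [Fintype E] [DecidableEq E] [Fintype G] [DecidableEq G]

theorem matOfOp_unitaryV (φ : E × G ≃ E × G) (p r : E × G) :
    matOfOp (unitaryV φ) p r = if p = φ r then 1 else 0 := by
  change matOfOp (∑ p, ketbra (φ p) p) p r = _
  rw [matOfOp_sum, Matrix.sum_apply, Finset.sum_eq_single r]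
  · simp [matOfOp_ketbra, Matrix.single_apply, eq_comm]
  · intro s _ hs
    simp [matOfOp_ketbra, hs]
  · simp

/-- V permutes the canonical basis, so diagonal matrices stay diagonal with their entries permuted.
This is how the classical map φ enters the operator side. -/
theorem star_unitaryV_finMul_unitaryV (φ : E × G ≃ E × G) (h : E × G → ℂ) :
    star (unitaryV φ) * finMul (E × G) h * unitaryV φ = finMul (E × G) (h ∘ φ) := by
  apply matOfOp_injective
  ext p r
  rw [matOfOp_mul, matOfOp_mul, matOfOp_star, matOfOp_finMul, matOfOp_finMul, Matrix.mul_apply,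
    Finset.sum_eq_single (φ r) (fun s _ hs => by simp [matOfOp_unitaryV, hs]) (by simp)]
  rw [Matrix.mul_diagonal, Matrix.star_apply, matOfOp_unitaryV, matOfOp_unitaryV,
    Matrix.diagonal_apply]
  by_cases hp : p = r
  · simp [hp]
  · simp [hp, Ne.symm hp]

theorem unitaryV_mem_unitary (φ : E × G ≃ E × G) : unitaryV φ ∈ unitary (Op (L2 (E × G))) := by
  have h : star (unitaryV φ) * unitaryV φ = 1 := by
    simpa [Function.comp_def, ← Pi.one_def] using star_unitaryV_finMul_unitaryV φ 1
  -- In finite dimension a left inverse is also a right inverse.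
  refine ⟨h, matOfOp_injective ?_⟩
  rw [matOfOp_mul, matOfOp_one, mul_eq_one_comm, ← matOfOp_mul, h, matOfOp_one]

theorem ampl_finMul (f : E → ℂ) : ampl G (finMul E f) = finMul (E × G) (f ∘ Prod.fst) := by
  apply matOfOp_injective
  ext p r
  simp only [matOfOp_ampl, matOfOp_finMul, Matrix.kroneckerMap_apply, Matrix.diagonal_apply,
    Matrix.one_apply, Prod.ext_iff, Function.comp]
  split_ifs <;> grind

end Permutation

/-! ### The homomorphism F ↦ m_F and its covariance -/

section GlobalMul

variable {A : Type} [CStarAlgebra A]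
variable {E G : Type} [Fintype E] [DecidableEq E] [TopologicalSpace E] [DiscreteTopology E]
  [Fintype G] [DecidableEq G] [TopologicalSpace G] [DiscreteTopology G]

/-- `f ↦ f(X_0)` as a *-homomorphism. -/
def sysVarHom (E G : Type) [TopologicalSpace E] [DiscreteTopology E] [TopologicalSpace G] :
    (E → ℂ) →⋆ₐ[ℂ] C(E × (ℤ → G), ℂ) where
  toFun := sysVar G
  map_one' := rfl
  map_mul' _ _ := rfl
  map_zero' := rfl
  map_add' _ _ := rfl
  commutes' _ := rfl
  map_star' _ := rfl

/-- `f ↦ f(Y_n)` as a *-homomorphism. -/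
def siteVarHom (E G : Type) [TopologicalSpace E] [TopologicalSpace G] [DiscreteTopology G]
    (n : ℤ) : (G → ℂ) →⋆ₐ[ℂ] C(E × (ℤ → G), ℂ) where
  toFun := siteVar E n
  map_one' := rfl
  map_mul' _ _ := rfl
  map_zero' := rfl
  map_add' _ _ := rfl
  commutes' _ := rfl
  map_star' _ := rfl

/-- This is the uniqueness half of `existsUnique_tensorHom`, applied to the coordinate restrictions
of `m'`, which commute because C(E × G^ℤ) is commutative. -/
theorem starAlgHom_ext_coordinates {m m' : C(E × (ℤ → G), ℂ) →⋆ₐ[ℂ] A}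
    (h1 : ∀ f, m (sysVar G f) = m' (sysVar G f))
    (h2 : ∀ n f, m (siteVar E n f) = m' (siteVar E n f)) : m = m' := by
  refine (existsUnique_tensorHom (m'.comp (sysVarHom E G)) (fun n => m'.comp (siteVarHom E G n))
    (fun f n g => ?_) (fun k n _ f g => ?_)).unique ⟨h1, h2⟩ ⟨fun _ => rfl, fun _ _ => rfl⟩
  · exact (Commute.all (sysVarHom E G f) (siteVarHom E G n g)).map m'
  · exact (Commute.all (siteVarHom E G k f) (siteVarHom E G n g)).map m'

theorem globalMul_sysVar (ψ : UnitVec (L2 G)) (f : E → ℂ) :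
    globalMul ψ (sysVar G f) = sysHom ψ (finMul E f) :=
  (existsUnique_globalMul ψ).choose_spec.1.1 f

theorem globalMul_siteVar (ψ : UnitVec (L2 G)) (n : ℤ) (f : G → ℂ) :
    globalMul ψ (siteVar E n f) = siteHom (L2 E) ψ n (finMul G f) :=
  (existsUnique_globalMul ψ).choose_spec.1.2 n f

/-- The existence half of `existsUnique_tensorHom`, with the subalgebra as target, produces a
homomorphism with values there; uniqueness identifies it with `globalMul`. -/
theorem globalMul_mem_globalAlg (ψ : UnitVec (L2 G)) (F : C(E × (ℤ → G), ℂ)) :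
    globalMul ψ F ∈ globalAlg (L2 E) ψ := by
  let u : (E → ℂ) →⋆ₐ[ℂ] genAlg (Set.range (sysHom ψ) ∪ ⋃ n : ℤ, Set.range (siteHom (L2 E) ψ n)) :=
    ((sysHom ψ).comp (finMul E)).codRestrict _ fun f => sysHom_mem_globalAlg _
  let w : ℤ → (G → ℂ) →⋆ₐ[ℂ]
      genAlg (Set.range (sysHom ψ) ∪ ⋃ n : ℤ, Set.range (siteHom (L2 E) ψ n)) := fun n =>
    ((siteHom (L2 E) ψ n).comp (finMul G)).codRestrict _ fun f => siteHom_mem_globalAlg _ _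
  obtain ⟨m, ⟨h1, h2⟩, -⟩ := existsUnique_tensorHom u w
    (fun f n g => Subtype.ext (sysHom_commute _ _ _).eq)
    (fun k n h f g => Subtype.ext (siteHom_commute h _ _).eq)
  have : globalMul ψ = (StarSubalgebra.subtype _).comp m := starAlgHom_ext_coordinates
    (fun f => (globalMul_sysVar ψ f).trans (congrArg Subtype.val (h1 f)).symm)
    (fun n f => (globalMul_siteVar ψ n f).trans (congrArg Subtype.val (h2 n f)).symm)
  rw [this]
  exact (m F).2

/-- The global random variable `h(X_0, Y_n)`. -/
def pairVar (n : ℤ) (h : E × G → ℂ) : C(E × (ℤ → G), ℂ) :=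
  ⟨fun ω => h (ω.1, ω.2 n), continuous_of_discreteTopology.comp
    (continuous_fst.prodMk ((continuous_apply n).comp continuous_snd))⟩

/-- After one step X_0 becomes a joint function of X_0 and Y_1, so single coordinates do not
suffice. Point indicators of E × G are products of coordinate indicators, and the diagonal matrix of
m_h leaves the same terms in `embedSite`. -/
theorem globalMul_pairVar (ψ : UnitVec (L2 G)) (n : ℤ) (h : E × G → ℂ) :
    globalMul ψ (pairVar n h) = embedSite ψ n (finMul (E × G) h) := by
  have e : pairVar n h = ∑ p : E × G, h p •
      (sysVar G (Pi.single p.1 1) * siteVar E n (Pi.single p.2 1)) := by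
    ext ω
    rw [ContinuousMap.sum_apply, Finset.sum_eq_single (ω.1, ω.2 n)]
    · simp [pairVar, sysVar, siteVar]
    · rintro ⟨i, g⟩ _ hne
      by_cases hi : ω.1 = i
      · have hg : ω.2 n ≠ g := fun hg => hne (by rw [hi, hg])
        simp [siteVar, hg]
      · simp [sysVar, hi]
    · simp
  rw [e, embedSite, map_sum]
  refine Finset.sum_congr rfl fun p _ => ?_
  rw [map_smul, map_mul, globalMul_sysVar, globalMul_siteVar, finMul_single, finMul_single,
    Finset.sum_eq_single p]
  · simp [matOfOp_finMul]
  · intro r _ hr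
    simp [matOfOp_finMul, hr.symm]
  · simp

theorem globalMul_comp_globalCont (ψ : UnitVec (L2 G)) (φ : E × G ≃ E × G)
    (F : C(E × (ℤ → G), ℂ)) :
    dynJ ψ (unitaryV φ) (globalMul ψ F) = globalMul ψ (F.comp (globalCont φ)) := by
  have hV := unitaryV_mem_unitary φ
  have : (unitaryConj (dynUnitary ψ hV)).comp (globalMul ψ) =
      (globalMul ψ).comp ((globalCont φ).compStarAlgHom' ℂ ℂ) := by
    refine starAlgHom_ext_coordinates (fun f => ?_) (fun n f => ?_)
    · change unitaryConj (dynUnitary ψ hV) (globalMul ψ (sysVar G f)) =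
        globalMul ψ ((sysVar G f).comp (globalCont φ))
      rw [unitaryConj_dynUnitary, globalMul_sysVar, dynJ_sysHom, ampl_finMul,
        star_unitaryV_finMul_unitaryV, ← globalMul_pairVar]
      rfl
    · change unitaryConj (dynUnitary ψ hV) (globalMul ψ (siteVar E n f)) =
        globalMul ψ ((siteVar E n f).comp (globalCont φ))
      rw [unitaryConj_dynUnitary]
      -- The shift places the freshly coupled coordinate at site 0: Y_0 ∘ α = φ^G(X_0, Y_1), while
      -- Y_n ∘ α = Y_{n+1} for n ≠ 0.
      by_cases hn : n = 0
      · subst hn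
        have e1 : siteHom (L2 E) ψ 1 (finMul G f) =
            embedSite ψ 1 (finMul (E × G) (f ∘ Prod.snd)) := by
          rw [← globalMul_pairVar, ← globalMul_siteVar]
          rfl
        rw [globalMul_siteVar, dynJ_siteHom_zero, e1, ← embedSite_star, ← embedSite_mul,
          ← embedSite_mul, star_unitaryV_finMul_unitaryV, ← globalMul_pairVar]
        congr 1
      · rw [globalMul_siteVar, dynJ_siteHom ψ hV hn, ← globalMul_siteVar]
        congr 1
        ext ω
        change f (ω.2 (n + 1)) = f (Function.update ω.2 1 _ (n + 1))
        rw [Function.update_of_ne (by omega)]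
  have h := congrArg (fun m => m F) this
  exact (unitaryConj_dynUnitary ψ hV _).symm.trans h

end GlobalMul
-- Joint functional calculus under *-homomorphisms
section JointCFC

open WeakDual

theorem isJointCFC_continuousMap {X : Type} [TopologicalSpace X] [CompactSpace X] {n : ℕ}
    (F : Fin n → C(X, ℂ)) {η : (Fin n → ℂ) → ℂ} (hη : Continuous η) :
    IsJointCFC F η ⟨fun x => η fun i => F i x, by fun_prop⟩ := by
  obtain ⟨b, hb, -⟩ := existsUnique_jointCFC F (fun i j => Commute.all _ _)
    (fun i j => Commute.all _ _) η hη
  have : b = ⟨fun x => η fun i => F i x, by fun_prop⟩ := by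
    obtain ⟨hmem, hχ⟩ := hb
    ext x
    -- Evaluation at x restricts to a character of the generated algebra, so the Gelfand condition
    -- at that character gives the value of b at x.
    let ev : C(X, ℂ) →⋆ₐ[ℂ] ℂ :=
      { ContinuousMap.evalAlgHom ℂ ℂ x with map_star' := fun _ => rfl }
    exact hχ (CharacterSpace.equivAlgHom.symm
      ((ev.comp (genAlg (Set.range F)).subtype : genAlg (Set.range F) →⋆ₐ[ℂ] ℂ) :
        genAlg (Set.range F) →ₐ[ℂ] ℂ))
  exact this ▸ hb

/-- Characters of the algebra generated by the images pull back along m to characters of the algebra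
generated by the a_i. -/
theorem IsJointCFC.map {A B : Type} [CStarAlgebra A] [CStarAlgebra B] (m : A →⋆ₐ[ℂ] B) {n : ℕ}
    {a : Fin n → A} {η : (Fin n → ℂ) → ℂ} {b : A} (h : IsJointCFC a η b) :
    IsJointCFC (fun i => m (a i)) η (m b) := by
  obtain ⟨hb, hχ⟩ := h
  have hle : genAlg (Set.range a) ≤ (genAlg (Set.range fun i => m (a i))).comap m :=
    genAlg_le_comap m _ _ isClosed_closure (by rintro _ ⟨i, rfl⟩; exact mem_genAlg ⟨i, rfl⟩)
  refine ⟨hle hb, fun χ => ?_⟩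
  let m' : genAlg (Set.range a) →⋆ₐ[ℂ] genAlg (Set.range fun i => m (a i)) :=
    (m.comp (genAlg (Set.range a)).subtype).codRestrict _ fun x => hle x.2
  exact hχ (CharacterSpace.equivAlgHom.symm
    ((CharacterSpace.equivAlgHom χ).comp (m' : _ →ₐ[ℂ] _)))

theorem jointCFC_eq {A : Type} [CStarAlgebra A] {n : ℕ} {a : Fin n → A} {η : (Fin n → ℂ) → ℂ}
    (h1 : ∀ i j, Commute (a i) (a j)) (h2 : ∀ i j, Commute (a i) (star (a j)))
    (hη : Continuous η) {b : A} (hb : IsJointCFC a η b) : jointCFC a η = b := by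
  have h : ∃ b, IsJointCFC a η b := ⟨b, hb⟩
  rw [jointCFC, dif_pos h]
  exact (existsUnique_jointCFC a h1 h2 η hη).unique h.choose_spec hb

/-- *-homomorphisms of `C(X)` intertwine the joint functional calculus with composition. -/
theorem jointCFC_starAlgHom {X : Type} [TopologicalSpace X] [CompactSpace X] {A : Type}
    [CStarAlgebra A] (m : C(X, ℂ) →⋆ₐ[ℂ] A) {n : ℕ} (F : Fin n → C(X, ℂ)) {η : (Fin n → ℂ) → ℂ}
    (hη : Continuous η) :
    jointCFC (fun i => m (F i)) η = m ⟨fun x => η fun i => F i x, by fun_prop⟩ :=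
  jointCFC_eq (fun i j => (Commute.all (F i) (F j)).map m)
    (fun i j => by rw [← map_star]; exact (Commute.all (F i) (star (F j))).map m) hη
    ((isJointCFC_continuousMap F hη).map m)

end JointCFC

/-! ### Trace against a rank-one operator -/

section Trace

/-- In any Hilbert basis the diagonal sum is the Parseval expansion of ⟨v, Xv⟩. -/
theorem hasTrace_mul_rankOne {H : Type} [NormedAddCommGroup H] [InnerProductSpace ℂ H]
    (X : Op H) (v : H) : HasTrace (X * InnerProductSpace.rankOne ℂ v v) ⟪v, X v⟫_ℂ := by
  intro ι b
  convert! b.hasSum_inner_mul_inner v (X v) using 2 with i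
  rw [mul_apply_eq_comp, InnerProductSpace.rankOne_apply, map_smul, inner_smul_right]

end Trace

/-! ### The vector υ and the distribution q -/

section Upsilon

theorem finMul_apply {S : Type} [Fintype S] [DecidableEq S] (f : S → ℂ) (v : L2 S) (i : S) :
    finMul S f v i = f i * v i := by
  change opOfMat _ v i = _
  simp [opOfMat_apply, Matrix.diagonal_apply]

variable {G : Type} [Fintype G] [DecidableEq G] [MeasurableSpace G] [DiscreteMeasurableSpace G]

theorem upsilon_apply (q : Measure G) [IsProbabilityMeasure q] (g : G) :
    (upsilon q).1 g = ((√(q.real {g}) : ℝ) : ℂ) := by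
  simp [upsilon, ket_apply]

theorem inner_upsilon_finMul (q : Measure G) [IsProbabilityMeasure q] (w : G → ℂ) :
    ⟪(upsilon q).1, finMul G w (upsilon q).1⟫_ℂ = ∫ g, w g ∂q := by
  rw [integral_fintype Integrable.of_finite, PiLp.inner_apply]
  refine Finset.sum_congr rfl fun g _ => ?_
  have h : ((√(q.real {g}) : ℝ) : ℂ) * ((√(q.real {g}) : ℝ) : ℂ) = (q.real {g} : ℝ) := by
    rw [← Complex.ofReal_mul, Real.mul_self_sqrt measureReal_nonneg]
  rw [finMul_apply, upsilon_apply, RCLike.inner_apply, Complex.conj_ofReal, Complex.real_smul, ← h]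
  ring

end Upsilon

/-! ### Vacuum expectations as classical expectations -/

section Expectation

set_option linter.unusedSectionVars false

variable {E G : Type} [Fintype E] [DecidableEq E] [TopologicalSpace E] [DiscreteTopology E]
  [Fintype G] [DecidableEq G] [TopologicalSpace G] [DiscreteTopology G]

/-- Cylinder functions on `E × G^ℤ`. -/
def cylinderAlg (E G : Type) [TopologicalSpace E] [TopologicalSpace G] :
    StarSubalgebra ℂ C(E × (ℤ → G), ℂ) where
  carrier := {F | ∃ N : Finset ℤ, ∀ i x y, (∀ n ∈ N, x n = y n) → F (i, x) = F (i, y)}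
  mul_mem' := by
    rintro F F' ⟨N, h⟩ ⟨N', h'⟩
    refine ⟨N ∪ N', fun i x y hxy => ?_⟩
    rw [ContinuousMap.mul_apply, ContinuousMap.mul_apply,
      h i x y fun n hn => hxy n (Finset.mem_union_left _ hn),
      h' i x y fun n hn => hxy n (Finset.mem_union_right _ hn)]
  add_mem' := by
    rintro F F' ⟨N, h⟩ ⟨N', h'⟩
    refine ⟨N ∪ N', fun i x y hxy => ?_⟩
    rw [ContinuousMap.add_apply, ContinuousMap.add_apply,
      h i x y fun n hn => hxy n (Finset.mem_union_left _ hn),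
      h' i x y fun n hn => hxy n (Finset.mem_union_right _ hn)]
  algebraMap_mem' c := ⟨∅, fun _ _ _ _ => rfl⟩
  star_mem' := by
    rintro F ⟨N, h⟩
    exact ⟨N, fun i x y hxy => congrArg star (h i x y hxy)⟩

theorem cylinderAlg_topologicalClosure : (cylinderAlg E G).topologicalClosure = ⊤ := by
  refine ContinuousMap.starSubalgebra_topologicalClosure_eq_top_of_separatesPoints _ ?_
  rintro ⟨i, x⟩ ⟨j, y⟩ hne
  by_cases h : i = j
  · obtain ⟨n, hxy⟩ : ∃ n, x n ≠ y n := by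
      by_contra! h'
      exact hne (Prod.ext h (funext h'))
    refine ⟨_, ⟨siteVar E n (Pi.single (x n) 1), ⟨{n}, fun k z w hzw => ?_⟩, rfl⟩, ?_⟩
    · simp [siteVar, hzw n (by simp)]
    · simp [siteVar, Pi.single_apply, hxy.symm]
  · refine ⟨_, ⟨sysVar G (Pi.single i 1), ⟨∅, fun k z w _ => rfl⟩, rfl⟩, ?_⟩
    simp [sysVar, Pi.single_apply, Ne.symm h]

/-- Continuous functionals that agree on products of one-coordinate functions are equal. -/
theorem clm_ext_products [Nonempty G] {L L' : C(E × (ℤ → G), ℂ) →L[ℂ] ℂ}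
    (h : ∀ (f : E → ℂ) (N : Finset ℤ) (w : ℤ → G → ℂ),
      L (sysVar G f * ∏ n ∈ N, siteVar E n (w n)) =
        L' (sysVar G f * ∏ n ∈ N, siteVar E n (w n))) : L = L' := by
  classical
  have hd : Dense (cylinderAlg E G : Set C(E × (ℤ → G), ℂ)) := by
    rw [dense_iff_closure_eq, ← StarSubalgebra.topologicalClosure_coe,
      cylinderAlg_topologicalClosure]
    rfl
  refine ContinuousLinearMap.coeFn_injective (Continuous.ext_on hd L.continuous L'.continuous ?_)
  rintro F ⟨N, hF⟩
  obtain ⟨g₀⟩ := ‹Nonempty G›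
  let ext (x : N → G) (n : ℤ) : G := if h : n ∈ N then x ⟨n, h⟩ else g₀
  -- A cylinder function over N is the finite sum of its values times point indicators, each a
  -- product of one-coordinate functions. The filler `g₀` outside N does not affect these values.
  have e : F = ∑ i : E, ∑ x : N → G, F (i, ext x) •
      (sysVar G (Pi.single i 1) * ∏ n ∈ N, siteVar E n (Pi.single (ext x n) 1)) := by
    ext ω
    rw [ContinuousMap.sum_apply, Finset.sum_eq_single ω.1, ContinuousMap.sum_apply,
      Finset.sum_eq_single (fun n : N => ω.2 n)]
    · have h0 : F (ω.1, ext fun n : N => ω.2 n) = F ω :=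
        hF _ _ _ fun n hn => by simp [ext, hn]
      rw [ContinuousMap.smul_apply, h0, ContinuousMap.mul_apply, ContinuousMap.prod_apply,
        Finset.prod_eq_one]
      · simp [sysVar]
      · intro n hn
        simp [siteVar, ext, hn]
    · intro x _ hx
      obtain ⟨n, hn⟩ : ∃ n : N, x n ≠ ω.2 n := by
        by_contra! h'
        exact hx (funext h')
      rw [ContinuousMap.smul_apply, ContinuousMap.mul_apply, ContinuousMap.prod_apply,
        Finset.prod_eq_zero n.2]
      · simp
      · simp [siteVar, ext, hn.symm]
    · simp
    · intro i _ hi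
      rw [ContinuousMap.sum_apply]
      exact Finset.sum_eq_zero fun x _ => by simp [sysVar, hi.symm]
    · simp
  rw [e]
  simp only [map_sum, map_smul, h]

/-- The sequence is described site by site so that the induction can continue: a newly inserted site
still carries ψ, and multiplication acts on it exactly once. -/
theorem globalMul_product_vac (ψ : UnitVec (L2 G)) (f : E → ℂ) (N : Finset ℤ) (w : ℤ → G → ℂ)
    (v : L2 E) : ∃ z : TailSeq ψ, (∀ n ∈ N, z.1 n = finMul G (w n) ψ.1) ∧
      (∀ n ∉ N, z.1 n = ψ.1) ∧
      globalMul ψ (sysVar G f * ∏ n ∈ N, siteVar E n (w n)) (vac ψ v) = tens z (finMul E f v) := by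
  induction N using Finset.induction_on with
  | empty =>
    refine ⟨constSeq ψ, by simp, fun _ _ => rfl, ?_⟩
    rw [Finset.prod_empty, mul_one, globalMul_sysVar]
    exact sysOp_tens _ _ _
  | insert m N hm ih =>
    obtain ⟨z, h1, h2, h3⟩ := ih
    refine ⟨z.set m (finMul G (w m) ψ.1), fun n hn => ?_, fun n hn => ?_, ?_⟩
    · by_cases h : n = m
      · rw [h, TailSeq.set_same]
      · rw [TailSeq.set_ne _ h, h1 n ((Finset.mem_insert.1 hn).resolve_left h)]
    · rw [Finset.mem_insert, not_or] at hn
      rw [TailSeq.set_ne _ hn.1, h2 n hn.2]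
    · rw [Finset.prod_insert hm, mul_left_comm, map_mul, mul_apply_eq_comp, h3, globalMul_siteVar]
      refine (siteOp_tens _ _ _ _).trans ?_
      rw [h2 m hm]

theorem inner_vac_globalMul_product (ψ : UnitVec (L2 G)) (f : E → ℂ) (N : Finset ℤ)
    (w : ℤ → G → ℂ) (v : L2 E) :
    ⟪vac ψ v, globalMul ψ (sysVar G f * ∏ n ∈ N, siteVar E n (w n)) (vac ψ v)⟫_ℂ =
      ⟪v, finMul E f v⟫_ℂ * ∏ n ∈ N, ⟪ψ.1, finMul G (w n) ψ.1⟫_ℂ := by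
  obtain ⟨z, h1, h2, h3⟩ := globalMul_product_vac ψ f N w v
  rw [h3, vac, tens_inner, tailInner_eq_prod ψ _ z N (fun _ _ => rfl) h2]
  congr 1
  exact Finset.prod_congr rfl fun n hn => by rw [h1 n hn]; rfl

variable [MeasurableSpace E] [DiscreteMeasurableSpace E]
  [MeasurableSpace G] [DiscreteMeasurableSpace G]

instance (q : Measure G) [IsProbabilityMeasure q] (k : E) :
    IsProbabilityMeasure (dilationMeasure q k) := by
  unfold dilationMeasure; infer_instance

theorem integral_product_dilationMeasure (q : Measure G) [IsProbabilityMeasure q] (k : E)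
    (f : E → ℂ) (N : Finset ℤ) (w : ℤ → G → ℂ) :
    ∫ ω, (sysVar G f * ∏ n ∈ N, siteVar E n (w n)) ω ∂dilationMeasure q k =
      f k * ∏ n ∈ N, ∫ g, w n g ∂q := by
  have h : ∀ ω : E × (ℤ → G), (sysVar G f * ∏ n ∈ N, siteVar E n (w n)) ω =
      f ω.1 * ∏ n ∈ N, w n (ω.2 n) := fun ω => by
    simp [ContinuousMap.prod_apply, sysVar, siteVar]
  simp only [h]
  rw [dilationMeasure, integral_prod_mul f fun x : ℤ → G => ∏ n ∈ N, w n (x n), integral_dirac]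
  congr 1
  have := integral_restrict_infinitePi (μ := fun _ : ℤ => q) (s := N)
    (f := fun x : N → G => ∏ n : N, w n (x n)) (Measurable.of_discrete).aestronglyMeasurable
  simp only [Finset.restrict] at this
  rw [← Finset.prod_coe_sort N fun n => ∫ g, w n g ∂q,
    ← integral_fintype_prod_eq_prod fun (n : N) g => w n g, ← this]
  refine integral_congr_ae (Filter.Eventually.of_forall fun x => ?_)
  exact (Finset.prod_coe_sort N fun n => w n (x n)).symm

theorem integrable_continuousMap (q : Measure G) [IsProbabilityMeasure q] (k : E)
    (F : C(E × (ℤ → G), ℂ)) : Integrable F (dilationMeasure q k) :=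
  (integrable_const ‖F‖).mono' F.continuous.aestronglyMeasurable
    (Filter.Eventually.of_forall F.norm_coe_le_norm)

/-- Both sides are continuous in F, and on products of one-coordinate functions both factor with the
same marginals: δ_k on E and, since |√q_g|² = q_g, the measure q at every site. -/
theorem inner_vac_globalMul (q : Measure G) [IsProbabilityMeasure q] (k : E)
    (F : C(E × (ℤ → G), ℂ)) :
    ⟪vac (upsilon q) (ket k), globalMul (upsilon q) F (vac (upsilon q) (ket k))⟫_ℂ =
      ∫ ω, F ω ∂dilationMeasure q k := by
  have : Nonempty G := q.nonempty_of_neZero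
  let L : C(E × (ℤ → G), ℂ) →L[ℂ] ℂ :=
    { toFun := fun F =>
        ⟪vac (upsilon q) (ket k), globalMul (upsilon q) F (vac (upsilon q) (ket k))⟫_ℂ
      map_add' := fun F F' => by simp
      map_smul' := fun c F => by simp
      cont := by
        have := starAlgHom_continuous (globalMul (E := E) (upsilon q))
        fun_prop }
  let L' : C(E × (ℤ → G), ℂ) →L[ℂ] ℂ := LinearMap.mkContinuous
    { toFun := fun F => ∫ ω, F ω ∂dilationMeasure q k
      map_add' := fun F F' => integral_add (integrable_continuousMap q k F)
        (integrable_continuousMap q k F')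
      map_smul' := fun c F => integral_smul c F } 1 fun F => by
        refine (norm_integral_le_of_norm_le_const
          (Filter.Eventually.of_forall F.norm_coe_le_norm)).trans ?_
        simp
  have h : L = L' := clm_ext_products fun f N w => by
    change ⟪vac (upsilon q) (ket k), globalMul (upsilon q) _ (vac (upsilon q) (ket k))⟫_ℂ =
      ∫ ω, (sysVar G f * ∏ n ∈ N, siteVar E n (w n)) ω ∂dilationMeasure q k
    rw [inner_vac_globalMul_product, integral_product_dilationMeasure, inner_ket_left, finMul_apply,
      ket_apply, if_pos rfl, mul_one]
    simp only [inner_upsilon_finMul]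
  exact congrArg (fun L => L F) h

end Expectation
-- Maps in Kraus form are stochastic
section Kraus

variable {H : Type} [NormedAddCommGroup H] [InnerProductSpace ℂ H]

/-- A bounded operator acting termwise on square summable sequences. -/
noncomputable def mapSeq (K : Op H) (x : lp (fun _ : ℕ => H) 2) : lp (fun _ : ℕ => H) 2 :=
  ⟨fun n => K (x n), memℓp_gen <| by
    have hx := (lp.memℓp x).summable (by norm_num)
    refine Summable.of_nonneg_of_le (fun n => by positivity) (fun n => ?_)
      (hx.mul_left (‖K‖ ^ (2 : ENNReal).toReal))
    rw [← Real.mul_rpow (norm_nonneg _) (norm_nonneg _)]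
    exact Real.rpow_le_rpow (norm_nonneg _) (K.le_opNorm _) (by norm_num)⟩

theorem continuous_ultraweak_tsum (x y : lp (fun _ : ℕ => H) 2) :
    Continuous[ultraweak H, inferInstance] fun a : Op H => ∑' n, ⟪x n, a (y n)⟫_ℂ :=
  continuous_iInf_dom (i := x) (continuous_iInf_dom (i := y) continuous_induced_dom)

variable [CompleteSpace H] {G : Type} [Fintype G]

/-- A functional a ↦ ∑ ⟨x_n, a y_n⟩ pulls back to the finite sum over g of the functionals of the
sequences K_g x_n and K_g y_n, which are again square summable. -/
theorem continuous_ultraweak_kraus (K : G → Op H) :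
    Continuous[ultraweak H, ultraweak H] fun a => ∑ g, star (K g) * a * K g := by
  refine continuous_iInf_rng.2 fun x => continuous_iInf_rng.2 fun y => continuous_induced_rng.2 ?_
  have e : (fun a : Op H => ∑' n, ⟪x n, a (y n)⟫_ℂ) ∘ (fun a => ∑ g, star (K g) * a * K g) =
      fun a => ∑ g, ∑' n, ⟪mapSeq (K g) x n, a (mapSeq (K g) y n)⟫_ℂ := by
    ext a
    have h : ∀ n, ⟪x n, (∑ g, star (K g) * a * K g) (y n)⟫_ℂ =
        ∑ g, ⟪mapSeq (K g) x n, a (mapSeq (K g) y n)⟫_ℂ := fun n => by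
      rw [sum_apply, inner_sum]
      refine Finset.sum_congr rfl fun g _ => ?_
      rw [mul_apply_eq_comp, mul_apply_eq_comp, ContinuousLinearMap.star_eq_adjoint,
        ContinuousLinearMap.adjoint_inner_right]
      rfl
    simp only [Function.comp, h]
    exact Summable.tsum_finsetSum fun g _ =>
      lp.summable_inner (𝕜 := ℂ) (mapSeq (K g) x) (mapSeq a (mapSeq (K g) y))
  rw [e]
  -- The finite sum must be continuous for the ultraweak topology, which here overrides the norm
  -- topology.
  let _ : TopologicalSpace (Op H) := ultraweak H
  exact continuous_finsetSum _ fun g _ => continuous_ultraweak_tsum _ _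

theorem kraus_completelyPositive (K : G → Op H) (k : ℕ) (M : CStarMatrix (Fin k) (Fin k) (Op H))
    (hM : 0 ≤ M) : 0 ≤ M.map fun a => ∑ g, star (K g) * a * K g := by
  -- With D_g = diag(K_g, …, K_g) the amplified map is M ↦ ∑ D_g* M D_g, which visibly preserves
  -- positivity.
  let D (g : G) : CStarMatrix (Fin k) (Fin k) (Op H) :=
    CStarMatrix.ofMatrix (Matrix.diagonal fun _ => K g)
  have e : M.map (fun a => ∑ g, star (K g) * a * K g) = ∑ g, star (D g) * M * D g := by
    have h : ∀ g i j, (star (D g) * M * D g) i j = star (K g) * M i j * K g := fun g i j => by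
      rw [CStarMatrix.mul_apply, Finset.sum_eq_single j, CStarMatrix.mul_apply,
        Finset.sum_eq_single i]
      · simp [D, CStarMatrix.star_apply]
      · intro l _ hl
        simp [D, CStarMatrix.star_apply, hl]
      · simp
      · intro l _ hl
        simp [D, hl]
      · simp
    refine CStarMatrix.ext fun i j => ?_
    rw [CStarMatrix.map_apply]
    have hs : ∀ s : Finset G, (∑ g ∈ s, star (D g) * M * D g) i j =
        ∑ g ∈ s, star (K g) * M i j * K g := by
      classical
      intro s
      induction s using Finset.induction_on with
      | empty => simp
      | insert a s ha ih =>
        rw [Finset.sum_insert ha, Finset.sum_insert ha, CStarMatrix.add_apply, ih, h]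
    exact (hs _).symm
  rw [e]
  exact Finset.sum_nonneg fun g _ => star_left_conjugate_nonneg hM _

theorem isStochasticMap_of_kraus (K : G → Op H) (h : ∑ g, star (K g) * K g = 1)
    (T : Module.End ℂ (Op H)) (hT : ∀ a, T a = ∑ g, star (K g) * a * K g) :
    IsStochasticMap T := by
  have e : (T : Op H → Op H) = fun a => ∑ g, star (K g) * a * K g := funext hT
  refine ⟨?_, fun k M hM => ?_, ?_, ?_⟩
  · rw [e]; fun_prop
  · rw [e]; exact kraus_completelyPositive K k M hM
  · rw [e]; exact continuous_ultraweak_kraus K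
  · simpa [hT] using h

end Kraus

/-! ### Conditional expectations with respect to vectors -/

section CondExp

set_option linter.unusedSectionVars false

variable {S K : Type} [Fintype S] [DecidableEq S] [Fintype K] [DecidableEq K]

theorem tensVec_apply (κ : L2 K) (h : L2 S) (p : S × K) : tensVec S κ h p = h p.1 * κ p.2 := rfl

theorem apply_eq_matOfOp (X : Op (L2 S)) (v : L2 S) (i : S) : X v i = ∑ j, matOfOp X i j * v j := by
  conv_lhs => rw [← opOfMat_matOfOp X]
  exact opOfMat_apply _ _ _

theorem matOfOp_condExpVec (κ κ' : L2 K) (X : Op (L2 (S × K))) (i j : S) :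
    matOfOp (condExpVec κ κ' X) i j = ∑ z', ∑ z, star (κ' z') * matOfOp X (i, z') (j, z) * κ z := by
  rw [matOfOp, condExpVec]
  change ⟪ket i, (tensVec S κ').adjoint (X (tensVec S κ (ket j)))⟫_ℂ = _
  rw [ContinuousLinearMap.adjoint_inner_right, PiLp.inner_apply, Fintype.sum_prod_type,
    Finset.sum_eq_single i]
  · refine Finset.sum_congr rfl fun z' _ => ?_
    rw [apply_eq_matOfOp, Fintype.sum_prod_type, Finset.sum_eq_single j]
    · simp [tensVec_apply, ket_apply, Finset.sum_mul]
      exact Finset.sum_congr rfl fun z _ => by ring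
    · intro k _ hk
      simp [tensVec_apply, ket_apply, hk]
    · simp
  · intro k _ hk
    simp [tensVec_apply, ket_apply, hk]
  · simp

/-- Sesquilinearity in κ and κ' expands the expectation into the basis slices that occur in the
recursion of `flow`. -/
theorem condExpVec_eq_sum (κ κ' : L2 K) (X : Op (L2 (S × K))) :
    condExpVec κ κ' X = ∑ z, ∑ z', (star (κ' z') * κ z) • condExpVec (ket z) (ket z') X := by
  apply matOfOp_injective
  ext i j
  have h : ∀ z z', matOfOp (condExpVec (ket z) (ket z') X) i j = matOfOp X (i, z') (j, z) := by
    intro z z'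
    simp [matOfOp_condExpVec, ket_apply]
  simp only [matOfOp_sum, Matrix.sum_apply, matOfOp_smul, Matrix.smul_apply, h]
  rw [matOfOp_condExpVec, Finset.sum_comm]
  exact Finset.sum_congr rfl fun z _ => Finset.sum_congr rfl fun z' _ => by
    rw [smul_eq_mul]; ring

theorem condExpVec_sum {ι : Type} (κ κ' : L2 K) (s : Finset ι) (X : ι → Op (L2 (S × K))) :
    condExpVec κ κ' (∑ x ∈ s, X x) = ∑ x ∈ s, condExpVec κ κ' (X x) := by
  ext v : 1
  simp [condExpVec]

theorem inner_ketbra (κ : L2 K) (z z' : K) :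
    ⟪κ, ketbra z' z κ⟫_ℂ = star (κ z') * κ z := by
  rw [ketbra, InnerProductSpace.rankOne_apply, inner_smul_right, inner_ket_left, inner_ket_right,
    mul_comm]

/-- This is a ⊗ 1 with 1 = ∑ |g⟩⟨g|; the summation index becomes the Kraus index of T. -/
theorem ampl_eq_sum (a : Op (L2 S)) :
    ampl K a = ∑ g : K, tensVec S (ket g) ∘L a ∘L (tensVec S (ket g)).adjoint := by
  have h : ∀ (g : K) (v : L2 (S × K)) (i : S), (tensVec S (ket g)).adjoint v i = v (i, g) := by
    intro g v i
    rw [← inner_ket_left, ContinuousLinearMap.adjoint_inner_right, PiLp.inner_apply,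
      Finset.sum_eq_single (i, g)]
    · simp [tensVec_apply, ket_apply]
    · rintro ⟨j, k⟩ _ hne
      by_cases hj : j = i
      · have : k ≠ g := fun hk => hne (by rw [hj, hk])
        simp [tensVec_apply, ket_apply, this]
      · simp [tensVec_apply, ket_apply, hj]
    · simp
  ext v p
  simp only [sum_apply, WithLp.ofLp_sum, Finset.sum_apply,
    ContinuousLinearMap.comp_apply, tensVec_apply, ket_apply]
  rw [Finset.sum_eq_single p.2 (fun g _ hg => by simp [hg.symm]) (by simp), if_pos rfl, mul_one,
    apply_eq_matOfOp, apply_eq_matOfOp, Fintype.sum_prod_type]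
  refine Finset.sum_congr rfl fun j _ => ?_
  rw [h, Finset.sum_eq_single p.2]
  · simp [matOfOp_ampl]
  · intro g _ hg
    simp [matOfOp_ampl, hg.symm]
  · simp

theorem condExpVec_one (κ : L2 K) (hκ : ‖κ‖ = 1) : condExpVec κ κ (1 : Op (L2 (S × K))) = 1 := by
  apply matOfOp_injective
  ext i j
  have h : ∑ z, star (κ z) * κ z = 1 := by
    have := inner_self_eq_norm_sq_to_K (𝕜 := ℂ) κ
    rw [PiLp.inner_apply, hκ] at this
    simpa only [RCLike.inner_apply, mul_comm, map_one, one_pow, Complex.star_def,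
      RCLike.ofReal_one] using this
  rw [matOfOp_condExpVec, matOfOp_one, matOfOp_one]
  by_cases hij : i = j
  · rw [hij, Matrix.one_apply_eq, ← h]
    simp [Matrix.one_apply]
  · simp [hij]

end CondExp

/-! ### The map T -/

section QDS

set_option linter.unusedSectionVars false

variable {E G : Type} [Fintype E] [DecidableEq E] [Fintype G] [DecidableEq G]
  [MeasurableSpace G] [DiscreteMeasurableSpace G]

theorem krausV_eq_condExpVec (φ : E × G ≃ E × G) (q : Measure G) [IsProbabilityMeasure q] (g : G) :
    krausV φ q g = condExpVec (upsilon q).1 (ket g) (unitaryV φ) := by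
  apply matOfOp_injective
  ext i j
  have h : ∀ g', matOfOp (blockV φ g g') i j = matOfOp (unitaryV φ) (i, g) (j, g') := by
    intro g'
    rw [matOfOp_unitaryV, blockV]
    simp only [matOfOp_sum, Matrix.sum_apply, matOfOp_smul, Matrix.smul_apply, matOfOp_ketbra]
    rw [Finset.sum_eq_single i, Finset.sum_eq_single j]
    · simp [inner_ket_left, ket_apply]
    · intro l _ hl
      simp [hl]
    · simp
    · intro k _ hk
      exact Finset.sum_eq_zero fun l _ => by simp [hk]
    · simp
  symm
  rw [matOfOp_condExpVec, Finset.sum_eq_single g, krausV, matOfOp_sum, Matrix.sum_apply]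
  · refine Finset.sum_congr rfl fun g' _ => ?_
    rw [matOfOp_smul, Matrix.smul_apply, h, upsilon_apply, ket_apply, if_pos rfl, star_one, one_mul,
      smul_eq_mul, mul_comm]
  · intro k _ hk
    simp [ket_apply, hk]
  · simp

theorem qdsMap_apply (φ : E × G ≃ E × G) (q : Measure G) (a : Op (L2 E)) :
    qdsMap φ q a = ∑ g : G, star (krausV φ q g) * a * krausV φ q g := rfl

/-- Splitting a ⊗ 1 between V* and V along the basis of Z leaves the slices ⟨g|V|υ⟩ on both sides.
Unitality, the extension of P and both dilation formulas are derived from this form. -/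
theorem qdsMap_eq_condExpVec (φ : E × G ≃ E × G) (q : Measure G) [IsProbabilityMeasure q]
    (a : Op (L2 E)) : qdsMap φ q a = condExpVec (upsilon q).1 (upsilon q).1
      (star (unitaryV φ) * ampl G a * unitaryV φ) := by
  rw [ampl_eq_sum, Finset.mul_sum, Finset.sum_mul, condExpVec_sum, qdsMap_apply]
  refine Finset.sum_congr rfl fun g _ => ?_
  rw [krausV_eq_condExpVec, condExpVec, condExpVec, ContinuousLinearMap.star_eq_adjoint,
    ContinuousLinearMap.adjoint_comp, ContinuousLinearMap.adjoint_comp,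
    ContinuousLinearMap.adjoint_adjoint]
  rfl

theorem qdsMap_one (φ : E × G ≃ E × G) (q : Measure G) [IsProbabilityMeasure q] :
    qdsMap φ q 1 = 1 := by
  have h : ampl G (1 : Op (L2 E)) = 1 := by
    simpa [Function.comp_def, ← Pi.one_def] using ampl_finMul (G := G) (1 : E → ℂ)
  rw [qdsMap_eq_condExpVec, h, mul_one, (unitaryV_mem_unitary φ).1, condExpVec_one _ (upsilon q).2]

theorem isStochasticMap_qdsMap (φ : E × G ≃ E × G) (q : Measure G) [IsProbabilityMeasure q] :
    IsStochasticMap (qdsMap φ q) :=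
  isStochasticMap_of_kraus (krausV φ q) (by simpa [qdsMap_apply] using qdsMap_one φ q) _
    (qdsMap_apply φ q)

end QDS
-- The quantum stochastic flow dilates T^t
section Flow

variable {E G : Type} [Fintype E] [DecidableEq E] [Fintype G] [DecidableEq G]

/-- The vector κ^{⊗(t+1)} and the matrix of X ⊗ b both factor over the last coordinate, so summing
that coordinate out yields ⟨κ, bκ⟩. -/
theorem condExpVec_appendSite {t : ℕ} (κ : L2 G) (X : Op (L2 (E × (Fin t → G)))) (b : Op (L2 G)) :
    condExpVec (tensPow (t + 1) κ) (tensPow (t + 1) κ) (appendSite X b) =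
      ⟪κ, b κ⟫_ℂ • condExpVec (tensPow t κ) (tensPow t κ) X := by
  apply matOfOp_injective
  ext i j
  have hb : ⟪κ, b κ⟫_ℂ = ∑ g, ∑ g', star (κ g) * matOfOp b g g' * κ g' := by
    rw [PiLp.inner_apply]
    refine Finset.sum_congr rfl fun g _ => ?_
    rw [apply_eq_matOfOp, RCLike.inner_apply, Finset.sum_mul]
    exact Finset.sum_congr rfl fun g' _ => by rw [Complex.star_def]; ring
  have hs : ∀ f : (Fin (t + 1) → G) → ℂ, ∑ x, f x = ∑ g, ∑ x : Fin t → G, f (Fin.snoc x g) := by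
    intro f
    rw [← (Fin.snocEquiv fun _ => G).sum_comp, Fintype.sum_prod_type]
    rfl
  have hp : ∀ (x : Fin t → G) (g : G), tensPow (t + 1) κ (Fin.snoc x g : Fin (t + 1) → G) =
      tensPow t κ x * κ g := by
    intro x g
    simp [tensPow, Fin.prod_univ_castSucc]
  rw [matOfOp_smul, Matrix.smul_apply, matOfOp_condExpVec, matOfOp_condExpVec, hs, hb, smul_eq_mul,
    Finset.sum_mul]
  refine Finset.sum_congr rfl fun g _ => ?_
  rw [Finset.mul_sum]
  refine Finset.sum_congr rfl fun x _ => ?_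
  rw [hs, Finset.sum_mul_sum]
  refine Finset.sum_congr rfl fun g' _ => Finset.sum_congr rfl fun x' _ => ?_
  rw [hp, hp, appendSite, matOfOp_opOfMat]
  simp only [Matrix.of_apply, Fin.snoc_castSucc, Fin.snoc_last, star_mul]
  ring

theorem condExpVec_ampl (κ : L2 G) (a : Op (L2 E)) :
    condExpVec (tensPow 0 κ) (tensPow 0 κ) (ampl (Fin 0 → G) a) = a := by
  apply matOfOp_injective
  ext i j
  simp [matOfOp_condExpVec, matOfOp_ampl, tensPow]

theorem condExpVec_flow (V : Op (L2 (E × G))) (κ : L2 G) (T : Module.End ℂ (Op (L2 E)))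
    (hT : ∀ a, T a = condExpVec κ κ (star V * ampl G a * V)) (t : ℕ) (a : Op (L2 E)) :
    condExpVec (tensPow t κ) (tensPow t κ) (flow V t a) = (T ^ t) a := by
  induction t generalizing a with
  | zero => exact condExpVec_ampl κ a
  | succ t ih =>
    simp only [flow, condExpVec_sum, condExpVec_appendSite, ih, inner_ketbra]
    -- T^{t+1} a is read as T^t(T a): the coefficients ⟨κ, |z'⟩⟨z| κ⟩ are exactly those expanding T
    -- a into slices, hence the induction over all a.
    rw [pow_succ, Module.End.mul_apply, hT, condExpVec_eq_sum]
    simp only [map_sum, map_smul]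

/-- Grouping the matrix units by their environment part separates system and site, so that J^t can
act on each factor separately. -/
theorem embedSite_eq_sum_condExpVec (ψ : UnitVec (L2 G)) (n : ℤ) (X : Op (L2 (E × G))) :
    embedSite ψ n X = ∑ z, ∑ z', sysHom ψ (condExpVec (ket z) (ket z') X) *
      siteHom (L2 E) ψ n (ketbra z' z) := by
  have h : ∀ z z', condExpVec (ket z) (ket z') X =
      ∑ i, ∑ j, matOfOp X (i, z') (j, z) • ketbra i j := fun z z' => by
    conv_lhs => rw [← sum_ketbra (condExpVec (ket z) (ket z') X)]
    simp [matOfOp_condExpVec, ket_apply]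
  simp only [h, map_sum, map_smul, Finset.sum_mul, smul_mul_assoc, embedSite, Fintype.sum_prod_type]
  calc _ = _ := Finset.sum_comm
    _ = _ := Finset.sum_congr rfl fun z' _ => ?_
    _ = _ := Finset.sum_comm
  symm
  rw [Finset.sum_comm]
  exact Finset.sum_congr rfl fun i _ => Finset.sum_comm

end Flow

/-! ### The automorphism group dilates T^t -/

section Group

set_option linter.unusedSectionVars false

variable {E G : Type} [Fintype E] [DecidableEq E] [Fintype G] [DecidableEq G]

theorem siteHom_vac {H Z : Type} [NormedAddCommGroup H] [InnerProductSpace ℂ H] [CompleteSpace H]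
    [NormedAddCommGroup Z] [InnerProductSpace ℂ Z] [CompleteSpace Z] (ψ : UnitVec Z) (n : ℤ)
    (b : Z →L[ℂ] Z) (h : H) :
    siteHom H ψ n b (vac ψ h) = tens ((constSeq ψ).set n (b ψ.1)) h :=
  siteOp_tens n b _ h

/-- Vacuum expectations factorize over a site with which an operator commutes. -/
theorem condExpVac_mul_siteHom {H Z : Type} [NormedAddCommGroup H] [InnerProductSpace ℂ H]
    [CompleteSpace H] [NormedAddCommGroup Z] [InnerProductSpace ℂ Z] [CompleteSpace Z]
    (ψ : UnitVec Z) {n : ℤ} {A : HK H ψ →L[ℂ] HK H ψ}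
    (hA : ∀ c, Commute A (siteHom H ψ n c)) (b : Z →L[ℂ] Z) :
    condExpVac ψ (A * siteHom H ψ n b) = ⟪ψ.1, b ψ.1⟫_ℂ • condExpVac ψ A := by
  -- The projection onto ψ at site n fixes the vacuum. Taken from the left vacuum vector and moved
  -- past A, it turns bψ into ⟨ψ, bψ⟩ψ.
  let p : Z →L[ℂ] Z := InnerProductSpace.rankOne ℂ ψ.1 ψ.1
  have hψ : ⟪ψ.1, ψ.1⟫_ℂ = 1 := by simp [inner_self_eq_norm_sq_to_K, ψ.2]
  have hp : p ψ.1 = ψ.1 := by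
    rw [InnerProductSpace.rankOne_apply, hψ, one_smul]
  have hps : star p = p := by
    rw [ContinuousLinearMap.star_eq_adjoint, ← ContinuousLinearMap.eq_adjoint_iff _ _ |>.2]
    intro x y
    simp only [p, InnerProductSpace.rankOne_apply, inner_smul_left, inner_smul_right,
      inner_conj_symm]
    ring
  have hvac : ∀ h : H, siteHom H ψ n p (vac ψ h) = vac ψ h := fun h => by
    rw [siteHom_vac, hp]
    exact congrArg (fun z => tens z h) ((constSeq ψ).set_self n)
  have hb : ∀ h : H, siteHom H ψ n p (siteHom H ψ n b (vac ψ h)) = ⟪ψ.1, b ψ.1⟫_ℂ • vac ψ h := by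
    intro h
    rw [← mul_apply_eq_comp, ← map_mul, siteHom_vac, mul_apply_eq_comp,
      InnerProductSpace.rankOne_apply, tens_set_smul]
    exact congrArg (fun z => _ • tens z h) ((constSeq ψ).set_self n)
  ext k
  refine ext_inner_left ℂ fun h => ?_
  change ⟪h, (vac ψ).adjoint (A (siteHom H ψ n b (vac ψ k)))⟫_ℂ =
    ⟪h, ⟪ψ.1, b ψ.1⟫_ℂ • (vac ψ).adjoint (A (vac ψ k))⟫_ℂ
  rw [inner_smul_right, ContinuousLinearMap.adjoint_inner_right,
    ContinuousLinearMap.adjoint_inner_right, ← inner_smul_right, ← map_smul, ← hb]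
  conv_lhs => rw [← hvac h]
  rw [← ContinuousLinearMap.adjoint_inner_right, ← ContinuousLinearMap.star_eq_adjoint,
    ← map_star, hps, ← mul_apply_eq_comp, ← (hA p).eq, mul_apply_eq_comp]

/-- As a conjugation, J^t is a *-homomorphism and so respects products and commutation. -/
theorem dynJ_iterate (ψ : UnitVec (L2 G)) {V : Op (L2 (E × G))}
    (hV : V ∈ unitary (Op (L2 (E × G)))) (t : ℕ) (A : Op (HK (L2 E) ψ)) :
    (dynJ ψ V)^[t] A = unitaryConj (dynUnitary ψ hV ^ t) A := by
  induction t with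
  | zero => simp [unitaryConj_apply]
  | succ t ih =>
    rw [Function.iterate_succ_apply', ih, ← unitaryConj_dynUnitary ψ hV]
    simp [unitaryConj_apply, pow_succ, mul_assoc]

theorem dynJ_iterate_siteHom (ψ : UnitVec (L2 G)) {V : Op (L2 (E × G))}
    (hV : V ∈ unitary (Op (L2 (E × G)))) (t : ℕ) {n : ℤ} (hn : 1 ≤ n) (b : Op (L2 G)) :
    (dynJ ψ V)^[t] (siteHom (L2 E) ψ n b) = siteHom (L2 E) ψ (n + t) b := by
  induction t with
  | zero => simp
  | succ t ih =>
    rw [Function.iterate_succ_apply', ih, dynJ_siteHom ψ hV (by omega)]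
    push_cast
    rw [add_assoc]

/-- For n > t, site n is the image under J^t of site n − t ≥ 1, which commutes with a ⊗ 1: after t
steps the system has not touched the sites beyond t. -/
theorem dynJ_iterate_sysHom_commute (ψ : UnitVec (L2 G)) {V : Op (L2 (E × G))}
    (hV : V ∈ unitary (Op (L2 (E × G)))) (t : ℕ) {n : ℤ} (hn : t < n) (a : Op (L2 E))
    (b : Op (L2 G)) : Commute ((dynJ ψ V)^[t] (sysHom ψ a)) (siteHom (L2 E) ψ n b) := by
  have h := dynJ_iterate_siteHom ψ hV t (n := n - t) (by omega) b
  rw [sub_add_cancel] at h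
  rw [← h, dynJ_iterate ψ hV, dynJ_iterate ψ hV]
  exact (sysHom_commute a (n - t) b).map _

theorem condExpVac_sum (ψ : UnitVec (L2 G)) {ι : Type} (s : Finset ι)
    (A : ι → Op (HK (L2 E) ψ)) : condExpVac ψ (∑ x ∈ s, A x) = ∑ x ∈ s, condExpVac ψ (A x) := by
  ext v : 1
  simp [condExpVac]

theorem condExpVac_sysHom (ψ : UnitVec (L2 G)) (a : Op (L2 E)) :
    condExpVac ψ (sysHom ψ a) = a := by
  ext1 k
  refine ext_inner_left ℂ fun h => ?_
  change ⟪h, (vac ψ).adjoint (sysOp ψ a (vac ψ k))⟫_ℂ = _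
  rw [ContinuousLinearMap.adjoint_inner_right, vac, sysOp_tens, tens_inner,
    tailInner_eq_prod ψ _ _ ∅ (fun _ _ => rfl) (fun _ _ => rfl), Finset.prod_empty, mul_one]

theorem condExpVac_dynJ_iterate (ψ : UnitVec (L2 G)) {V : Op (L2 (E × G))}
    (hV : V ∈ unitary (Op (L2 (E × G)))) (T : Module.End ℂ (Op (L2 E)))
    (hT : ∀ a, T a = condExpVec ψ.1 ψ.1 (star V * ampl G a * V)) (t : ℕ) (a : Op (L2 E)) :
    condExpVac ψ ((dynJ ψ V)^[t] (sysHom ψ a)) = (T ^ t) a := by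
  induction t generalizing a with
  | zero => exact condExpVac_sysHom ψ a
  | succ t ih =>
    have h : ∀ z z' : G, condExpVac ψ (unitaryConj (dynUnitary ψ hV ^ t)
        (sysHom ψ (condExpVec (ket z) (ket z') (star V * ampl G a * V)) *
          siteHom (L2 E) ψ 1 (ketbra z' z))) = (star (ψ.1 z') * ψ.1 z) •
        (T ^ t) (condExpVec (ket z) (ket z') (star V * ampl G a * V)) := by
      intro z z'
      rw [map_mul, ← dynJ_iterate, ← dynJ_iterate, dynJ_iterate_siteHom ψ hV t le_rfl,
        condExpVac_mul_siteHom ψ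
          (fun c => dynJ_iterate_sysHom_commute ψ hV t (by omega) _ c), ih, inner_ketbra]
    -- The innermost J is expanded over H ⊗ Z_1. The remaining J^t carries site 1 to site t + 1,
    -- where the vacuum expectation factors off.
    rw [Function.iterate_succ_apply, dynJ_sysHom, dynJ_iterate ψ hV, embedSite_eq_sum_condExpVec]
    simp only [map_sum, condExpVac_sum, h]
    rw [pow_succ, Module.End.mul_apply, hT, condExpVec_eq_sum]
    simp only [map_sum, map_smul]

end Group

/-! ### Transition probabilities and the extension of P -/

section Markov

set_option linter.unusedSectionVars false

variable {E G : Type} [Fintype E] [DecidableEq E] [MeasurableSpace E] [DiscreteMeasurableSpace E]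
  [Fintype G] [DecidableEq G] [MeasurableSpace G] [DiscreteMeasurableSpace G]

theorem integral_dilationMeasure_eval (q : Measure G) [IsProbabilityMeasure q] (k : E) (n : ℤ)
    (h : E × G → ℝ) :
    ∫ ω, h (ω.1, ω.2 n) ∂dilationMeasure q k = ∑ g, q.real {g} * h (k, g) := by
  have hm : MeasurePreserving (fun ω : E × (ℤ → G) => (ω.1, ω.2 n)) (dilationMeasure q k)
      ((Measure.dirac k).prod q) :=
    (MeasurePreserving.id (Measure.dirac k)).prod
      (measurePreserving_eval_infinitePi (fun _ : ℤ => q) n)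
  have hf : Measurable h := Measurable.of_discrete
  rw [← integral_map (φ := fun ω : E × (ℤ → G) => (ω.1, ω.2 n)) hm.measurable.aemeasurable
    hf.aestronglyMeasurable, hm.map_eq, integral_prod _ Integrable.of_finite, integral_dirac,
    integral_fintype Integrable.of_finite]
  rfl

/-- The Markov property at time 0 is integrated under ℙ_i: the conditional expectation integrates to
ℙ_i(φ^E(X_0, Y_1) = j), and P(X_0, j) integrates to P_{ij}, as X_0 = i almost surely. -/
theorem IsStandardDilation.transition_eq {P : Matrix E E ℝ} {φ : E × G ≃ E × G} {q : Measure G}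
    [IsProbabilityMeasure q] (hdil : IsStandardDilation P φ q) (i j : E) :
    P i j = ∑ g, q.real {g} * if (φ (i, g)).1 = j then 1 else 0 := by
  have hprob : IsProbabilityMeasure (dilationMeasure q i) := by
    unfold dilationMeasure; infer_instance
  have hc := integral_congr_ae (hdil.markov i 0 j)
  have hq : ∑ g, q.real {g} = 1 := by rw [sum_measureReal_singleton]; simp
  rw [integral_condExp ((dilationFiltration E G).le 0)] at hc
  -- The integrand depends on X_0 alone, so the choice of site 0 is immaterial.
  have e2 := integral_dilationMeasure_eval q i 0 fun p => P p.1 j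
  dsimp only at e2
  rw [← Finset.sum_mul, hq, one_mul] at e2
  have e1 := integral_dilationMeasure_eval q i 1 fun p => if (φ p).1 = j then 1 else 0
  rw [← e1, ← e2]
  refine hc.symm.trans (integral_congr_ae (Filter.Eventually.of_forall fun ω => ?_))
  change Set.indicator {ω : E × (ℤ → G) | (φ (ω.1, ω.2 1)).1 = j} (fun _ => (1 : ℝ)) ω = _
  rw [Set.indicator_apply]
  rfl

/-- V*(m_f ⊗ 1)V is multiplication by f ∘ φ^E, and its expectation in υ averages over g with weights
q_g, giving Pf by `IsStandardDilation.transition_eq`. -/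
theorem extendsMarkov_qdsMap {P : Matrix E E ℝ} {φ : E × G ≃ E × G} {q : Measure G}
    [IsProbabilityMeasure q] (hdil : IsStandardDilation P φ q) :
    ExtendsMarkov (qdsMap φ q) P := by
  intro f
  rw [qdsMap_eq_condExpVec, ampl_finMul, star_unitaryV_finMul_unitaryV]
  apply matOfOp_injective
  ext i j
  rw [matOfOp_condExpVec, matOfOp_finMul, matOfOp_finMul]
  by_cases hij : i = j
  · subst hij
    have hs : ∀ g : G, ((√(q.real {g}) : ℝ) : ℂ) * ((√(q.real {g}) : ℝ) : ℂ) =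
        (q.real {g} : ℝ) := fun g => by
      rw [← Complex.ofReal_mul, Real.mul_self_sqrt measureReal_nonneg]
    rw [Matrix.diagonal_apply_eq]
    simp only [hdil.transition_eq i, Complex.ofReal_sum, Finset.sum_mul]
    refine Eq.trans ?_ Finset.sum_comm
    refine Finset.sum_congr rfl fun g _ => ?_
    -- On the left only the diagonal term g' = g survives; on the right only the state φ^E(i, g).
    refine (Finset.sum_eq_single g ?_ ?_).trans
      (Eq.symm ((Finset.sum_eq_single (φ (i, g)).1 ?_ ?_).trans ?_))
    · intro g' _ hg
      simp [hg.symm]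
    · simp
    · intro l _ hl
      simp [hl.symm]
    · simp
    · rw [Matrix.diagonal_apply_eq, upsilon_apply, Complex.star_def, Complex.conj_ofReal,
        mul_right_comm, hs]
      simp
  · simp [hij]

end Markov
end QPD

open QPD in
theorem theorem2 {E G : Type}
    [Fintype E] [DecidableEq E] [Nonempty E] [TopologicalSpace E] [DiscreteTopology E]
    [MeasurableSpace E] [DiscreteMeasurableSpace E]
    [Fintype G] [DecidableEq G] [TopologicalSpace G] [DiscreteTopology G]
    [MeasurableSpace G] [DiscreteMeasurableSpace G]
    (P : Matrix E E ℝ) (hP : P ∈ Matrix.rowStochastic ℝ E)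
    (φ : E × G ≃ E × G) (q : Measure G) [IsProbabilityMeasure q]
    (hdil : IsStandardDilation P φ q) :
    (∀ ψ : UnitVec (L2 G),
      (∃ J : globalAlg (L2 E) ψ ≃⋆ₐ[ℂ] globalAlg (L2 E) ψ,
        ∀ A, (J A : Op (HK (L2 E) ψ)) = dynJ ψ (unitaryV φ) A) ∧
      ∀ F : C(E × (ℤ → G), ℂ), globalMul ψ F ∈ globalAlg (L2 E) ψ ∧
        dynJ ψ (unitaryV φ) (globalMul ψ F) = globalMul ψ (F.comp (globalCont φ))) ∧
    (∀ (k : E) (n : ℕ) (F : Fin n → C(E × (ℤ → G), ℂ)) (η : (Fin n → ℂ) → ℂ),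
      Continuous η → (∃ C : ℝ, ∀ z, ‖η z‖ ≤ C) →
      Integrable (fun ω => η fun i => F i ω) (dilationMeasure q k) ∧
      HasTrace
        (jointCFC (fun i => globalMul (upsilon q) (F i)) η *
          InnerProductSpace.rankOne ℂ (vac (upsilon q) (ket k)) (vac (upsilon q) (ket k)))
        (∫ ω, η (fun i => F i ω) ∂dilationMeasure q k)) ∧
    IsQPDilation (unitaryV φ) (upsilon q) (qdsMap φ q) ∧
    ExtendsMarkov (qdsMap φ q) P := by
  have hV := unitaryV_mem_unitary φ
  refine ⟨fun ψ => ⟨exists_starAlgEquiv_dynJ ψ hV, fun F =>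
    ⟨globalMul_mem_globalAlg ψ F, globalMul_comp_globalCont ψ φ F⟩⟩, fun k n F η hη _ => ?_,
    ⟨hV, isStochasticMap_qdsMap φ q, fun t a => ?_, fun t a => ?_⟩, extendsMarkov_qdsMap hdil⟩
  · let F' : C(E × (ℤ → G), ℂ) := ⟨fun ω => η fun i => F i ω, by fun_prop⟩
    refine ⟨integrable_continuousMap q k F', ?_⟩
    rw [jointCFC_starAlgHom (globalMul (upsilon q)) F hη]
    have h := hasTrace_mul_rankOne (globalMul (upsilon q) F') (vac (upsilon q) (ket k))
    rw [inner_vac_globalMul] at h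
    exact h
  · exact (condExpVec_flow _ _ _ (qdsMap_eq_condExpVec φ q) t a).symm
  · exact (condExpVac_dynJ_iterate _ hV _ (qdsMap_eq_condExpVec φ q) t a).symm
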